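/- An $(n,m,s)$-instance of Set Partition is a bipartite graph with sides $F$ and $U$, $|F|=m$, $|U|=n$, and an integer $s\ge 0$. For $f\in F$ let $N(f)\subseteq U$ be its set of neighbours, and $N(S)=\bigcup_{f\in S}N(f)$ for $S\subseteq F$. A set partition of size $s$ is a set $S\subseteq F$ with $|S|=s$, $N(S)=U$ and $N(f)\cap N(f')=\emptyset$ for all distinct $f,f'\in S$. For a real number $\beta>0$, a set $W\subseteq U$ is a witness $\beta$-halve if $(\tfrac12-\beta)n\le |W|\le(\tfrac12+\beta)n$ and there are disjoint $S_1,S_2\subseteq F$ with $N(S_1\cup S_2)=U$, $\sum_{f\in S_1\cup S_2}|N(f)|=n$, $N(S_1)=W$, $N(S_2)=U\setminus W$ and $|S_1|+|S_2|=s$. Theorem. There is a randomized algorithm that receives $n$, $s$ and real numbers $\beta,\zeta>0$ with $2\sqrt{\beta}\le\zeta<1/4$, and accesses the graph of an $(n,m,s)$-instance of Set Partition only through an oracle that, given $X\subseteq U$, decides in time $T\ge 1$ whether there exists $f\in F$ with $N(f)=X$, such that the following hold. (1) For all outcomes of its coin tosses, the algorithm halts within time $2^{(1-(\zeta/2)^4)n}\cdot\mathrm{poly}(n)\cdot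 T$. (2) Suppose that at most one $f\in F$ has $N(f)=\emptyset$. Then (a) for every constant $c>0$ there is a constant $p>0$, depending only on $c$, such that if there are at least $c\,2^{\zeta n}$ witness $\beta$-halves, then the algorithm outputs YES with probability at least $p$; and (b) if there is no set partition of size $s$, then the algorithm always outputs NO. Here an algorithm is a single program, and the polynomial a single polynomial, for all $n,m,s,\beta,\zeta,T$ and all instances. Programs run on a random access machine with fair coin tosses and unit-cost operations on words, correctly for every word length that is at least a certain polynomial in $n$ and large enough for $s$ to fit into a word; each real input $x$ is accessed by asking for $\lfloor kx\rfloor$ for a nonnegative integer $k$ of the program's choice. -/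

import Mathlib

open MeasureTheory

/-! ### Set Partition and witness halves -/

/-- An `(n, m, s)`-instance of Set Partition: a bipartite graph with sides `F = Fin m` and
`U = Fin n`, given by the neighbourhood `N f ⊆ U` of every `f ∈ F`, and the solution size `s`. -/
structure SetPartitionInstance (n m s : ℕ) where
  N : Fin m → Finset (Fin n)

namespace SetPartitionInstance

variable {n m s : ℕ}

/-- `N(S)`, the union of the neighbourhoods of the members of `S`. -/
def nbhd (I : SetPartitionInstance n m s) (S : Finset (Fin m)) : Finset (Fin n) :=
  S.biUnion I.N

/-- There is a set partition of size (exactly) `s`. -/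
def HasSetPartition (I : SetPartitionInstance n m s) : Prop :=
  ∃ S : Finset (Fin m), I.nbhd S = Finset.univ ∧ S.card = s ∧
    ∀ f ∈ S, ∀ f' ∈ S, f ≠ f' → Disjoint (I.N f) (I.N f')

/-- `W` is a witness `β`-halve. -/
def IsWitnessHalve (I : SetPartitionInstance n m s) (β : ℝ) (W : Finset (Fin n)) : Prop :=
  (W.card : ℝ) ∈ Set.Icc ((1 / 2 - β) * n) ((1 / 2 + β) * n) ∧
    ∃ S₁ S₂ : Finset (Fin m), Disjoint S₁ S₂ ∧ I.nbhd (S₁ ∪ S₂) = Finset.univ ∧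
      ∑ f ∈ S₁ ∪ S₂, (I.N f).card = n ∧ I.nbhd S₁ = W ∧ I.nbhd S₂ = Wᶜ ∧
      S₁.card + S₂.card = s

/-- At most one `f ∈ F` has an empty neighbourhood. -/
def AtMostOneEmpty (I : SetPartitionInstance n m s) : Prop :=
  ∀ f f' : Fin m, I.N f = ∅ → I.N f' = ∅ → f = f'

/-- What the oracle decides about `X ⊆ U`: whether `N(f) = X` for some `f ∈ F`. -/
def member (I : SetPartitionInstance n m s) (X : Finset (Fin n)) : Prop :=
  ∃ f : Fin m, I.N f = X

end SetPartitionInstance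

/-! ### Randomized word RAM with oracle access

A program is a finite structured command over numbered variables and an array of memory cells
with random access. All contents are words of `w` bits, that is, numbers below `2 ^ w`. -/

namespace WordRAM

/-- Binary operations of the machine. -/
inductive BinOp
  | add | sub | mul | div | land | lor | shl | shr | lt | eq

/-- The value of an operation on words of `w` bits; subtraction wraps around, and the
comparisons return `1` or `0`. -/
def BinOp.eval (w : ℕ) : BinOp → ℕ → ℕ → ℕ
  | .add, a, b => (a + b) % 2 ^ w
  | .sub, a, b => (a + (2 ^ w - b)) % 2 ^ w
  | .mul, a, b => (a * b) % 2 ^ w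
  | .div, a, b => (a / b) % 2 ^ w
  | .land, a, b => (a &&& b) % 2 ^ w
  | .lor, a, b => (a ||| b) % 2 ^ w
  | .shl, a, b => (a <<< b) % 2 ^ w
  | .shr, a, b => (a >>> b) % 2 ^ w
  | .lt, a, b => (if a < b then 1 else 0) % 2 ^ w
  | .eq, a, b => (if a = b then 1 else 0) % 2 ^ w

/-- Expressions: constants, variables, memory cells at computed addresses, operations. -/
inductive Expr
  | const (k : ℕ)
  | var (i : ℕ)
  | load (addr : Expr)
  | bin (o : BinOp) (a b : Expr)

/-- Machine states: variables, memory, and the number of coins flipped so far. -/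
structure State where
  var : ℕ → ℕ
  mem : ℕ → ℕ
  flips : ℕ

/-- The value of an expression. -/
def Expr.eval (w : ℕ) (σ : State) : Expr → ℕ
  | .const k => k % 2 ^ w
  | .var i => σ.var i
  | .load a => σ.mem (a.eval w σ)
  | .bin o a b => o.eval w (a.eval w σ) (b.eval w σ)

/-- The time to evaluate an expression: one step for each of its nodes. -/
def Expr.cost : Expr → ℕ
  | .const _ => 1
  | .var _ => 1
  | .load a => a.cost + 1
  | .bin _ a b => a.cost + b.cost + 1

/-- Commands. `floorBeta x e` and `floorZeta x e` are the access to the two real inputs;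
`query x e` is the access to the oracle; `flip x` tosses a fair coin. -/
inductive Cmd
  | assign (x : ℕ) (e : Expr)
  | store (addr e : Expr)
  | flip (x : ℕ)
  | query (x : ℕ) (e : Expr)
  | floorBeta (x : ℕ) (e : Expr)
  | floorZeta (x : ℕ) (e : Expr)
  | seq (c d : Cmd)
  | ite (e : Expr) (c d : Cmd)
  | while (e : Expr) (c : Cmd)

/-- What a run depends on besides the program and the initial state: the word length, the
membership oracle on subsets of `Fin n` and its query time, the real inputs, the coin tosses. -/
structure Env (n : ℕ) where
  w : ℕ
  oracle : Finset (Fin n) → Prop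
  T : ℕ
  β : ℝ
  ζ : ℝ
  coin : ℕ → Bool

/-- The subset of `Fin n` with characteristic bits `x`. -/
def subsetOfBits (n x : ℕ) : Finset (Fin n) :=
  Finset.univ.filter fun i => x.testBit i

def State.setVar (σ : State) (x v : ℕ) : State :=
  { σ with var := Function.update σ.var x v }

def State.setMem (σ : State) (a v : ℕ) : State :=
  { σ with mem := Function.update σ.mem a v }

open Classical in
/-- `Exec E c σ σ' t`: the command `c`, started in `σ`, halts in `σ'` after `t` time steps. -/
inductive Exec {n : ℕ} (E : Env n) : Cmd → State → State → ℕ → Prop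
  | assign (x : ℕ) (e : Expr) (σ : State) :
      Exec E (.assign x e) σ (σ.setVar x (e.eval E.w σ)) (e.cost + 1)
  | store (a e : Expr) (σ : State) :
      Exec E (.store a e) σ (σ.setMem (a.eval E.w σ) (e.eval E.w σ)) (a.cost + e.cost + 1)
  | flip (x : ℕ) (σ : State) :
      Exec E (.flip x) σ
        { σ.setVar x ((E.coin σ.flips).toNat % 2 ^ E.w) with flips := σ.flips + 1 } 1
  | query (x : ℕ) (e : Expr) (σ : State) :
      Exec E (.query x e) σ
        (σ.setVar x ((if E.oracle (subsetOfBits n (e.eval E.w σ)) then 1 else 0) % 2 ^ E.w))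
        (e.cost + E.T + 1)
  | floorBeta (x : ℕ) (e : Expr) (σ : State) :
      Exec E (.floorBeta x e) σ
        (σ.setVar x (⌊(e.eval E.w σ : ℝ) * E.β⌋₊ % 2 ^ E.w)) (e.cost + 1)
  | floorZeta (x : ℕ) (e : Expr) (σ : State) :
      Exec E (.floorZeta x e) σ
        (σ.setVar x (⌊(e.eval E.w σ : ℝ) * E.ζ⌋₊ % 2 ^ E.w)) (e.cost + 1)
  | seq {c d : Cmd} {σ σ' σ'' : State} {t t' : ℕ} :
      Exec E c σ σ' t → Exec E d σ' σ'' t' → Exec E (.seq c d) σ σ'' (t + t')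
  | iteTrue {e : Expr} {c d : Cmd} {σ σ' : State} {t : ℕ} :
      e.eval E.w σ ≠ 0 → Exec E c σ σ' t → Exec E (.ite e c d) σ σ' (e.cost + 1 + t)
  | iteFalse {e : Expr} {c d : Cmd} {σ σ' : State} {t : ℕ} :
      e.eval E.w σ = 0 → Exec E d σ σ' t → Exec E (.ite e c d) σ σ' (e.cost + 1 + t)
  | whileTrue {e : Expr} {c : Cmd} {σ σ' σ'' : State} {t t' : ℕ} :
      e.eval E.w σ ≠ 0 → Exec E c σ σ' t → Exec E (.while e c) σ' σ'' t' →
      Exec E (.while e c) σ σ'' (e.cost + 1 + t + t')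
  | whileFalse {e : Expr} {c : Cmd} {σ : State} :
      e.eval E.w σ = 0 → Exec E (.while e c) σ σ (e.cost + 1)

/-- The initial state: `n` and `s` in the variables `0` and `1`, everything else `0`. -/
def init (n s : ℕ) : State where
  var i := if i = 0 then n else if i = 1 then s else 0
  mem _ := 0
  flips := 0

/-- The output is read off variable `0`: nonzero is YES, zero is NO. -/
def State.Yes (σ : State) : Prop := σ.var 0 ≠ 0

/-- The law of a sequence of independent fair coin tosses. -/
noncomputable def coinMeasure : Measure (ℕ → Bool) :=
  Measure.infinitePi fun _ => (PMF.uniformOfFintype Bool).toMeasure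

end WordRAM

/-! Put z = ζ/2, so that β ≤ z² and z < 1/8. The algorithm draws M = 2^(n - ⌊nζ⌋) uniform subsets of
U, keeps each X with | 2|X| - n | ≤ ⌊2nβ⌋, and builds the downset D generated by the kept sets and
their complements (`reach`). It answers YES if for some Y with Y and Yᶜ both in D there is a
solution that splits along Y and Yᶜ (`Splits`).

Soundness: sets that cover U and have total size n are disjoint, so `Splits Y` for any Y yields a
set partition (`hasSetPartition_of_splits`), and the error is one-sided. Completeness: a witness
halve W satisfies `Splits W` (`splits_of_isWitnessHalve`), and once W is drawn, W and Wᶜ lie in D.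
If there are c·2^(ζn) witness halves, all M draws miss them with probability at most e^(-c)
(`coinMeasure_hit_ge`), whence p(c) = 1 - e^(-c).

`Splits` is decided by counting. On D one computes the zeta transform of a weighted indicator of the
nonempty neighbourhoods, then power sums, then the Möbius transform; both transforms only look at
subsets, so a downset suffices. The result at Y is a generating function of the tuples of
neighbourhoods with union exactly Y (`geomSum_zetaVal`, `moebiusVal_card`). Length and total size
are exponents of a power of two so large that no carries occur, hence a generating function is one
word, and one digit of the product of the values at Y and Yᶜ decides `Splits Y` (`digit_pairVal`).

Time: the work is polynomial per draw and per member of D, with one query per nonempty member and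
one more. `card_reach_le` bounds D. By Chernoff at most 2^((1-z⁴)n) sets have size at most n/2 -
z²n. Every other member misses at most 2z²n elements of a generator of size at most (1/2+z²)n; a
generator has at most 2^((2z-z⁴)n) such subsets (`entropy_bound`), and there are at most 2M ≤
4·2^((1-2z)n) generators. -/

namespace WordRAM

/-! ### Determinism, and a Hoare calculus with time bounds. -/

variable {n : ℕ} {E : Env n}

/-- Execution is deterministic. -/
theorem Exec.unique {c : Cmd} {σ σ₁ σ₂ : State} {t₁ t₂ : ℕ} (h₁ : Exec E c σ σ₁ t₁)
    (h₂ : Exec E c σ σ₂ t₂) : σ₁ = σ₂ := by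
  induction h₁ generalizing σ₂ t₂ with
  | assign | store | flip | query | floorBeta | floorZeta => cases h₂; rfl
  | seq _ _ ih₁ ih₂ =>
    cases h₂ with
    | seq a b => cases ih₁ a; exact ih₂ b
  | iteTrue h _ ih =>
    cases h₂ with
    | iteTrue _ a => exact ih a
    | iteFalse h' _ => exact absurd h' h
  | iteFalse h _ ih =>
    cases h₂ with
    | iteTrue h' _ => exact absurd h h'
    | iteFalse _ a => exact ih a
  | whileTrue h _ _ ih₁ ih₂ =>
    cases h₂ with
    | whileTrue _ a b => cases ih₁ a; exact ih₂ b
    | whileFalse h' => exact absurd h' h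
  | whileFalse h =>
    cases h₂ with
    | whileTrue h' _ _ => exact absurd h h'
    | whileFalse _ => rfl

/-- Total correctness with a time bound: from `σ`, the command `c` halts within `τ` steps in a
state that satisfies `Q`. -/
def Runs (E : Env n) (c : Cmd) (σ : State) (τ : ℕ) (Q : State → Prop) : Prop :=
  ∃ σ' t, Exec E c σ σ' t ∧ t ≤ τ ∧ Q σ'

section rules
variable {c d : Cmd} {σ : State} {τ τ' : ℕ} {Q Q' : State → Prop}

theorem Runs.mono (h : Runs E c σ τ Q) (hτ : τ ≤ τ') (hQ : ∀ σ, Q σ → Q' σ) :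
    Runs E c σ τ' Q' := by
  obtain ⟨σ', t, h, ht, q⟩ := h
  exact ⟨σ', t, h, ht.trans hτ, hQ _ q⟩

theorem Runs.within (h : Runs E c σ τ Q) (hτ : τ ≤ τ') : Runs E c σ τ' Q :=
  h.mono hτ fun _ => id

theorem Runs.assign {x : ℕ} {e : Expr} (v : ℕ) (he : e.eval E.w σ = v) (hQ : Q (σ.setVar x v)) :
    Runs E (.assign x e) σ (e.cost + 1) Q :=
  ⟨_, _, .assign x e σ, le_rfl, by rw [he]; exact hQ⟩

theorem Runs.store {a e : Expr} (u v : ℕ) (ha : a.eval E.w σ = u) (he : e.eval E.w σ = v)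
    (hQ : Q (σ.setMem u v)) : Runs E (.store a e) σ (a.cost + e.cost + 1) Q :=
  ⟨_, _, .store a e σ, le_rfl, by rw [ha, he]; exact hQ⟩

theorem Runs.flip {x : ℕ} (hw : 0 < E.w)
    (hQ : Q { σ.setVar x (E.coin σ.flips).toNat with flips := σ.flips + 1 }) :
    Runs E (.flip x) σ 1 Q := by
  refine ⟨_, _, .flip x σ, le_rfl, ?_⟩
  rwa [Nat.mod_eq_of_lt]
  exact lt_of_le_of_lt (Bool.toNat_le _) (Nat.one_lt_two_pow hw.ne')

open Classical in
theorem Runs.query {x : ℕ} {e : Expr} (hw : 0 < E.w) (v : ℕ) (he : e.eval E.w σ = v)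
    (hQ : Q (σ.setVar x (if E.oracle (subsetOfBits n v) then 1 else 0))) :
    Runs E (.query x e) σ (e.cost + E.T + 1) Q := by
  refine ⟨_, _, .query x e σ, le_rfl, ?_⟩
  rw [he]
  rwa [Nat.mod_eq_of_lt]
  exact lt_of_le_of_lt (by split_ifs <;> simp) (Nat.one_lt_two_pow hw.ne')

theorem Runs.floorBeta {x : ℕ} {e : Expr} (v : ℕ) (he : e.eval E.w σ = v)
    (hv : ⌊(v : ℝ) * E.β⌋₊ < 2 ^ E.w) (hQ : Q (σ.setVar x ⌊(v : ℝ) * E.β⌋₊)) :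
    Runs E (.floorBeta x e) σ (e.cost + 1) Q := by
  refine ⟨_, _, .floorBeta x e σ, le_rfl, ?_⟩
  rwa [he, Nat.mod_eq_of_lt hv]

theorem Runs.floorZeta {x : ℕ} {e : Expr} (v : ℕ) (he : e.eval E.w σ = v)
    (hv : ⌊(v : ℝ) * E.ζ⌋₊ < 2 ^ E.w) (hQ : Q (σ.setVar x ⌊(v : ℝ) * E.ζ⌋₊)) :
    Runs E (.floorZeta x e) σ (e.cost + 1) Q := by
  refine ⟨_, _, .floorZeta x e σ, le_rfl, ?_⟩
  rwa [he, Nat.mod_eq_of_lt hv]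

theorem Runs.seq (h : Runs E c σ τ fun σ' => Runs E d σ' τ' Q) :
    Runs E (.seq c d) σ (τ + τ') Q := by
  obtain ⟨σ', t, h, ht, σ'', t', h', ht', q⟩ := h
  exact ⟨σ'', t + t', .seq h h', by omega, q⟩

/-- Charging for both branches keeps the bound independent of the test, so the bound of a composite
command is a closed expression. -/
theorem Runs.ite {e : Expr} (h₁ : e.eval E.w σ ≠ 0 → Runs E c σ τ Q)
    (h₂ : e.eval E.w σ = 0 → Runs E d σ τ' Q) :
    Runs E (.ite e c d) σ (e.cost + 1 + (τ + τ')) Q := by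
  by_cases he : e.eval E.w σ = 0
  · obtain ⟨σ', t, h, ht, q⟩ := h₂ he
    exact ⟨σ', _, .iteFalse he h, by omega, q⟩
  · obtain ⟨σ', t, h, ht, q⟩ := h₁ he
    exact ⟨σ', _, .iteTrue he h, by omega, q⟩

/-- The invariant carries the number of completed passes. As the guard can hold only at pass numbers
below `N`, induction on the number of remaining passes gives termination. -/
theorem Runs.while {e : Expr} (N : ℕ) (Inv : ℕ → State → Prop) (h₀ : Inv 0 σ)
    (hc : ∀ k σ, Inv k σ → e.eval E.w σ ≠ 0 → k < N ∧ Runs E c σ τ (Inv (k + 1)))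
    (hQ : ∀ k σ, Inv k σ → e.eval E.w σ = 0 → Q σ) :
    Runs E (.while e c) σ ((e.cost + 1 + τ) * N + (e.cost + 1)) Q := by
  suffices H : ∀ r k σ, N ≤ k + r → Inv k σ →
      Runs E (.while e c) σ ((e.cost + 1 + τ) * r + (e.cost + 1)) Q from
    H N 0 σ (by omega) h₀
  intro r
  induction r with
  | zero =>
    intro k σ hk hI
    have he : e.eval E.w σ = 0 := by
      by_contra he
      have := (hc k σ hI he).1
      omega
    exact ⟨σ, _, .whileFalse he, by omega, hQ k σ hI he⟩
  | succ r ih =>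
    intro k σ hk hI
    by_cases he : e.eval E.w σ = 0
    · exact ⟨σ, _, .whileFalse he, by omega, hQ k σ hI he⟩
    · obtain ⟨_, σ', t, h, ht, hI'⟩ := hc k σ hI he
      obtain ⟨σ'', t', h', ht', q⟩ := ih (k + 1) σ' (by omega) hI'
      exact ⟨σ'', _, .whileTrue he h h', by rw [Nat.mul_succ]; omega, q⟩

end rules

/-! ### Evaluation of expressions without overflow. -/

section eval
variable {w : ℕ} {σ : State} {a b : Expr} {x y : ℕ}

theorem eval_const {k : ℕ} (h : k < 2 ^ w) : (Expr.const k).eval w σ = k := Nat.mod_eq_of_lt h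

theorem eval_var (i : ℕ) (h : σ.var i = x) : (Expr.var i).eval w σ = x := h

theorem eval_load (ha : a.eval w σ = x) (h : σ.mem x = y) : (Expr.load a).eval w σ = y := by
  simp [Expr.eval, ha, h]

theorem eval_add (ha : a.eval w σ = x) (hb : b.eval w σ = y) (h : x + y < 2 ^ w) :
    (Expr.bin .add a b).eval w σ = x + y := by
  simp [Expr.eval, BinOp.eval, ha, hb, Nat.mod_eq_of_lt h]

theorem eval_sub (ha : a.eval w σ = x) (hb : b.eval w σ = y) (h : x < 2 ^ w) (hxy : y ≤ x) :
    (Expr.bin .sub a b).eval w σ = x - y := by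
  have : x + (2 ^ w - y) = (x - y) + 2 ^ w := by omega
  simp only [Expr.eval, BinOp.eval, ha, hb, this, Nat.add_mod_right]
  exact Nat.mod_eq_of_lt (by omega)

theorem eval_mul (ha : a.eval w σ = x) (hb : b.eval w σ = y) (h : x * y < 2 ^ w) :
    (Expr.bin .mul a b).eval w σ = x * y := by
  simp [Expr.eval, BinOp.eval, ha, hb, Nat.mod_eq_of_lt h]

theorem eval_shl (ha : a.eval w σ = x) (hb : b.eval w σ = y) (h : x * 2 ^ y < 2 ^ w) :
    (Expr.bin .shl a b).eval w σ = x * 2 ^ y := by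
  simp [Expr.eval, BinOp.eval, ha, hb, Nat.shiftLeft_eq, Nat.mod_eq_of_lt h]

theorem eval_shr (ha : a.eval w σ = x) (hb : b.eval w σ = y) (h : x < 2 ^ w) :
    (Expr.bin .shr a b).eval w σ = x / 2 ^ y := by
  simp only [Expr.eval, BinOp.eval, ha, hb, Nat.shiftRight_eq_div_pow]
  exact Nat.mod_eq_of_lt ((Nat.div_le_self _ _).trans_lt h)

theorem eval_land_mask (ha : a.eval w σ = x) (hb : b.eval w σ = 2 ^ y - 1) (h : x < 2 ^ w) :
    (Expr.bin .land a b).eval w σ = x % 2 ^ y := by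
  simp only [Expr.eval, BinOp.eval, ha, hb, Nat.and_two_pow_sub_one_eq_mod]
  exact Nat.mod_eq_of_lt ((Nat.mod_le _ _).trans_lt h)

theorem eval_lt (hw : 0 < w) (ha : a.eval w σ = x) (hb : b.eval w σ = y) :
    (Expr.bin .lt a b).eval w σ = if x < y then 1 else 0 := by
  have := Nat.one_lt_two_pow hw.ne'
  simp only [Expr.eval, BinOp.eval, ha, hb]
  exact Nat.mod_eq_of_lt (by split_ifs <;> omega)

end eval

section state
variable (σ : State) (x v y : ℕ)

@[simp] theorem State.setVar_var : (σ.setVar x v).var y = if y = x then v else σ.var y := by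
  simp [State.setVar, Function.update_apply]

@[simp] theorem State.setVar_mem : (σ.setVar x v).mem = σ.mem := rfl

@[simp] theorem State.setVar_flips : (σ.setVar x v).flips = σ.flips := rfl

@[simp] theorem State.setMem_var : (σ.setMem x v).var = σ.var := rfl

@[simp] theorem State.setMem_mem : (σ.setMem x v).mem y = if y = x then v else σ.mem y := by
  simp [State.setMem, Function.update_apply]

end state

/-- `for i = 0, …, N - 1`, where `N` is the content of the variable `j`. -/
def Cmd.forUpto (i j : ℕ) (c : Cmd) : Cmd :=
  .seq (.assign i (.const 0)) (.while (.bin .lt (.var i) (.var j))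
    (.seq c (.assign i (.bin .add (.var i) (.const 1)))))

/-- The limit is read from variable `j` in every pass, hence `hj`. The body has to hand the counter
back unchanged, and the invariant is demanded after the increment. -/
theorem Runs.forUpto {i j τ : ℕ} {c : Cmd} {σ : State} {Q : State → Prop} (N : ℕ)
    (Inv : ℕ → State → Prop) (hN : N < 2 ^ E.w) (hw : 0 < E.w) (h₀ : Inv 0 (σ.setVar i 0))
    (hj : ∀ k σ, Inv k σ → σ.var j = N)
    (hc : ∀ k σ, k < N → σ.var i = k → Inv k σ →
      Runs E c σ τ fun σ' => σ'.var i = k ∧ Inv (k + 1) (σ'.setVar i (k + 1)))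
    (hQ : ∀ σ, Inv N σ → Q σ) :
    Runs E (.forUpto i j c) σ ((τ + 8) * (N + 1)) Q := by
  have h1 := Nat.one_lt_two_pow hw.ne'
  refine Runs.within (τ := 2 + ((4 + (τ + 4)) * N + 4)) (.seq ?_)
    (by have := Nat.zero_le (τ * N); ring_nf; omega)
  refine .assign 0 (eval_const (by omega)) ?_
  refine .while N (fun k σ => k ≤ N ∧ σ.var i = k ∧ Inv k σ) ⟨Nat.zero_le _, by simp, h₀⟩ ?_ ?_
  · rintro k σ ⟨hk, hi, hI⟩ he
    rw [eval_lt hw (eval_var i hi) (eval_var j (hj k σ hI))] at he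
    have hk : k < N := by by_contra h; simp [h] at he
    refine ⟨hk, .seq ((hc k σ hk hi hI).mono le_rfl ?_)⟩
    rintro σ' ⟨hi', hI'⟩
    exact .assign (k + 1) (eval_add (eval_var i hi') (eval_const (by omega)) (by omega))
      ⟨hk, by simp, hI'⟩
  · rintro k σ ⟨hk, hi, hI⟩ he
    rw [eval_lt hw (eval_var i hi) (eval_var j (hj k σ hI))] at he
    have : k = N := by
      by_contra h
      have : k < N := by omega
      simp [this] at he
    exact hQ σ (this ▸ hI)

end WordRAM

/-! ### Digits of sums of powers -/

/-- There are no carries, since each exponent occurs fewer than `2 ^ b` times. In the induction step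
the terms with top exponent form a multiple of `2 ^ (b * k)`, and the others stay below one further
such multiple. -/
theorem sum_two_pow_lt {τ : Type*} (A : Finset τ) (e : τ → ℕ) (b k : ℕ)
    (h : ∀ j < k, (A.filter fun t => e t = j).card < 2 ^ b) (hA : ∀ t ∈ A, e t < k) :
    ∑ t ∈ A, 2 ^ (b * e t) < 2 ^ (b * k) := by
  classical
  induction k generalizing A with
  | zero =>
    have : A = ∅ := Finset.eq_empty_of_forall_notMem fun t ht => by simpa using hA t ht
    simp [this]
  | succ k ih =>
    rw [← Finset.sum_filter_add_sum_filter_not A (fun t => e t = k)]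
    have h1 : ∑ t ∈ A with e t = k, 2 ^ (b * e t)
        = (A.filter fun t => e t = k).card * 2 ^ (b * k) := by
      rw [Finset.card_eq_sum_ones, Finset.sum_mul]
      refine Finset.sum_congr rfl fun t ht => ?_
      rw [(Finset.mem_filter.1 ht).2, one_mul]
    have h2 := ih (A.filter fun t => ¬ e t = k)
      (fun j hj => lt_of_le_of_lt (Finset.card_le_card
        (Finset.filter_subset_filter _ (Finset.filter_subset _ _))) (h j (by omega)))
      (fun t ht => by
        have := hA t (Finset.mem_filter.1 ht).1
        have := (Finset.mem_filter.1 ht).2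
        omega)
    have h3 := h k (by omega)
    rw [h1, Nat.mul_succ, pow_add, mul_comm (2 ^ (b * k))]
    have : ((A.filter fun t => e t = k).card + 1) * 2 ^ (b * k) ≤ 2 ^ b * 2 ^ (b * k) :=
      Nat.mul_le_mul_right _ h3
    rw [add_mul, one_mul] at this
    omega

/-- The `k`-th digit in base `2 ^ b` of a sum of powers counts the summands with exponent `k`. -/
theorem digit_sum_two_pow {τ : Type*} (A : Finset τ) (e : τ → ℕ) (b k : ℕ)
    (h : ∀ j ≤ k, (A.filter fun t => e t = j).card < 2 ^ b) :
    (∑ t ∈ A, 2 ^ (b * e t)) / 2 ^ (b * k) % 2 ^ b = (A.filter fun t => e t = k).card := by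
  classical
  -- Terms with exponent below `k` disappear in the division; terms with exponent above `k` are
  -- multiples of `2 ^ (b * (k + 1))` and disappear modulo `2 ^ b`.
  have hlow := sum_two_pow_lt (A.filter fun t => e t < k) e b k
    (fun j hj => lt_of_le_of_lt (Finset.card_le_card
        (Finset.filter_subset_filter _ (Finset.filter_subset _ _))) (h j hj.le))
    (fun t ht => (Finset.mem_filter.1 ht).2)
  obtain ⟨H, hH⟩ : 2 ^ (b * (k + 1)) ∣ ∑ t ∈ A with k < e t, 2 ^ (b * e t) :=
    Finset.dvd_sum fun t ht => pow_dvd_pow _ (Nat.mul_le_mul_left _ (Finset.mem_filter.1 ht).2)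
  have hmid : ∑ t ∈ A with e t = k, 2 ^ (b * e t)
        = (A.filter fun t => e t = k).card * 2 ^ (b * k) := by
    rw [Finset.card_eq_sum_ones, Finset.sum_mul]
    refine Finset.sum_congr rfl fun t ht => ?_
    rw [(Finset.mem_filter.1 ht).2, one_mul]
  have hsplit : ∑ t ∈ A, 2 ^ (b * e t) = ∑ t ∈ A with e t < k, 2 ^ (b * e t)
      + (∑ t ∈ A with e t = k, 2 ^ (b * e t) + ∑ t ∈ A with k < e t, 2 ^ (b * e t)) := by
    simp only [Finset.sum_filter, ← Finset.sum_add_distrib]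
    refine Finset.sum_congr rfl fun t _ => ?_
    rcases lt_trichotomy (e t) k with h | h | h
    · simp [h, h.ne, h.not_gt]
    · simp [h]
    · simp [h, h.ne', h.not_gt]
  have hpos : 0 < 2 ^ (b * k) := by positivity
  rw [hsplit, hmid, hH, Nat.mul_succ, pow_add,
    show (A.filter fun t => e t = k).card * 2 ^ (b * k) + 2 ^ (b * k) * 2 ^ b * H
      = 2 ^ (b * k) * ((A.filter fun t => e t = k).card + 2 ^ b * H) by ring,
    Nat.add_mul_div_left _ _ hpos, Nat.div_eq_of_lt hlow, zero_add, Nat.add_mul_mod_self_left,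
    Nat.mod_eq_of_lt (h k le_rfl)]

/-! ### Subsets of U as words. -/

namespace WordRAM
variable {n : ℕ}

/-- The number whose binary digits indicate the members of `X`. -/
def bits (X : Finset (Fin n)) : ℕ := ∑ i ∈ X, 2 ^ (i : ℕ)

/-- This makes `bits` a case of the digit lemmas with `b = 1`. -/
theorem bits_card_le_one (X : Finset (Fin n)) (j : ℕ) :
    (X.filter fun i : Fin n => (i : ℕ) = j).card < 2 ^ 1 := by
  refine Nat.lt_succ_of_le (Finset.card_le_one.2 fun a ha b hb => ?_)
  simp only [Finset.mem_filter] at ha hb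
  exact Fin.ext (ha.2.trans hb.2.symm)

theorem bits_lt (X : Finset (Fin n)) : bits X < 2 ^ n := by
  simpa [bits] using sum_two_pow_lt X (fun i : Fin n => (i : ℕ)) 1 n
    (fun j _ => bits_card_le_one X j) (fun i _ => i.2)

theorem bits_div_mod (X : Finset (Fin n)) (i : Fin n) :
    bits X / 2 ^ (i : ℕ) % 2 ^ 1 = if i ∈ X then 1 else 0 := by
  have := digit_sum_two_pow X (fun i : Fin n => (i : ℕ)) 1 i (fun j _ => bits_card_le_one X j)
  simp only [one_mul] at this
  rw [bits, this]
  simp only [Fin.val_inj, Finset.filter_eq', apply_ite Finset.card, Finset.card_singleton,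
    Finset.card_empty]

theorem subsetOfBits_bits (X : Finset (Fin n)) : subsetOfBits n (bits X) = X := by
  ext i
  have := bits_div_mod X i
  by_cases h : i ∈ X <;> simp_all [subsetOfBits, Nat.testBit_eq_decide_div_mod_eq]

theorem bits_injective : Function.Injective (bits (n := n)) := fun X Y h => by
  rw [← subsetOfBits_bits X, h, subsetOfBits_bits]

@[simp] theorem bits_inj {X Y : Finset (Fin n)} : bits X = bits Y ↔ X = Y := bits_injective.eq_iff

@[simp] theorem bits_empty : bits (∅ : Finset (Fin n)) = 0 := by simp [bits]

theorem bits_erase_add {X : Finset (Fin n)} {i : Fin n} (h : i ∈ X) :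
    bits (X.erase i) + 2 ^ (i : ℕ) = bits X := Finset.sum_erase_add _ _ h

theorem bits_univ : bits (Finset.univ : Finset (Fin n)) + 1 = 2 ^ n := by
  rw [bits, Fin.sum_univ_eq_sum_range (fun i => 2 ^ i), Nat.geomSum_eq le_rfl]
  have := Nat.one_le_two_pow (n := n)
  omega

theorem bits_compl (X : Finset (Fin n)) : bits Xᶜ + bits X + 1 = 2 ^ n := by
  rw [← bits_univ, bits, bits, bits, Finset.sum_compl_add_sum]

end WordRAM

/-! ### Sums over covers -/

section coverSum
variable {n : ℕ} {τ : Type*}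

/-- The total weight of the indices `t ∈ A` with `Y ∩ C ⊆ u t ⊆ Y`. -/
def coverSum (A : Finset τ) (u : τ → Finset (Fin n)) (wt : τ → ℕ) (C Y : Finset (Fin n)) : ℕ :=
  ∑ t ∈ A with u t ⊆ Y ∧ Y ∩ C ⊆ u t, wt t

variable (A : Finset τ) (u : τ → Finset (Fin n)) (wt : τ → ℕ) (C Y : Finset (Fin n))

theorem coverSum_le : coverSum A u wt C Y ≤ ∑ t ∈ A, wt t :=
  Finset.sum_le_sum_of_subset (Finset.filter_subset _ _)

theorem coverSum_insert_of_notMem {i : Fin n} (h : i ∉ Y) :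
    coverSum A u wt (insert i C) Y = coverSum A u wt C Y := by
  rw [coverSum, coverSum, Finset.inter_insert_of_notMem h]

/-- Split the indices counted on the right by whether `u t` contains `i`. Those without `i` are the
ones counted for `Y.erase i`, because `i ∉ C` leaves the covering condition unchanged. As `C` moves
between `∅` (all `u t ⊆ Y`) and everything (`u t = Y`), this is the step of both fast transforms. -/
theorem coverSum_insert_add {i : Fin n} (h : i ∈ Y) (hC : i ∉ C) :
    coverSum A u wt (insert i C) Y + coverSum A u wt C (Y.erase i) = coverSum A u wt C Y := by
  simp only [coverSum, Finset.sum_filter, ← Finset.sum_add_distrib]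
  refine Finset.sum_congr rfl fun t _ => ?_
  simp only [Finset.inter_insert_of_mem h, Finset.subset_erase, Finset.erase_inter,
    Finset.erase_eq_of_notMem (show i ∉ Y ∩ C by simp [hC]), Finset.insert_subset_iff]
  by_cases hi : i ∈ u t <;> simp [hi]

theorem coverSum_univ : coverSum A u wt Finset.univ Y = ∑ t ∈ A with u t = Y, wt t := by
  simp only [coverSum, Finset.inter_univ]
  congr 1
  ext t
  simp [Finset.Subset.antisymm_iff]

end coverSum

/-! ### Tuples of parts and their weights. -/

namespace SetPartitionInstance
variable {n m s : ℕ} (I : SetPartitionInstance n m s)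

open Classical in
/-- The nonempty neighbourhoods. -/
noncomputable def parts : Finset (Finset (Fin n)) :=
  Finset.univ.filter fun X => I.member X ∧ X ≠ ∅

/-- The tuples of at most `n` nonempty neighbourhoods. -/
noncomputable def tuples : Finset (Σ j : ℕ, Fin j → Finset (Fin n)) :=
  (Finset.range (n + 1)).sigma fun j => Fintype.piFinset fun _ : Fin j => I.parts

theorem card_parts_le : I.parts.card ≤ 2 ^ n := by
  refine (Finset.card_le_univ _).trans ?_
  simp

theorem card_tuples_le : I.tuples.card ≤ 2 ^ (n * n + n) := by
  rw [tuples, Finset.card_sigma]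
  calc ∑ j ∈ Finset.range (n + 1), (Fintype.piFinset fun _ : Fin j => I.parts).card
      ≤ ∑ j ∈ Finset.range (n + 1), 2 ^ (n * n) := by
        refine Finset.sum_le_sum fun j hj => ?_
        rw [Fintype.card_piFinset]
        simp only [Finset.prod_const, Finset.card_univ, Fintype.card_fin]
        rw [Finset.mem_range] at hj
        calc I.parts.card ^ j ≤ (2 ^ n) ^ j := Nat.pow_le_pow_left I.card_parts_le _
          _ = 2 ^ (n * j) := (pow_mul _ _ _).symm
          _ ≤ 2 ^ (n * n) := Nat.pow_le_pow_right (by norm_num) (Nat.mul_le_mul_left _ (by omega))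
    _ = (n + 1) * 2 ^ (n * n) := by simp
    _ ≤ 2 ^ n * 2 ^ (n * n) := Nat.mul_le_mul_right _ Nat.lt_two_pow_self
    _ = 2 ^ (n * n + n) := by rw [← pow_add, add_comm]

theorem mem_tuples {t : Σ j : ℕ, Fin j → Finset (Fin n)} :
    t ∈ I.tuples ↔ t.1 ≤ n ∧ ∀ i, I.member (t.2 i) ∧ t.2 i ≠ ∅ := by
  simp [tuples, parts]

end SetPartitionInstance

/-- The union of the members of a tuple. -/
def tupleUnion {n : ℕ} (t : Σ j : ℕ, Fin j → Finset (Fin n)) : Finset (Fin n) :=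
  Finset.univ.biUnion t.2

/-- The sum of the cardinalities of the members of a tuple. -/
def tupleCard {n : ℕ} (t : Σ j : ℕ, Fin j → Finset (Fin n)) : ℕ := ∑ i, (t.2 i).card

/-- The base-`2` logarithm of the base of the number system in which sums over tuples are
written; it also separates length and total size within the exponents. -/
def radix (n : ℕ) : ℕ := 2 * ((n + 1) * (n + 1))

/-- With `x = 2 ^ radix n`, a set weighs `x ^ (radix n + |X|)`. In a product the exponent of `x`
then records the number of factors in units of `radix n`, and on top of that the total size. -/
def setWeight {n : ℕ} (X : Finset (Fin n)) : ℕ := 2 ^ (radix n * (radix n + X.card))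

def tupleExp {n : ℕ} (t : Σ j : ℕ, Fin j → Finset (Fin n)) : ℕ := radix n * t.1 + tupleCard t

def tupleWeight {n : ℕ} (t : Σ j : ℕ, Fin j → Finset (Fin n)) : ℕ := 2 ^ (radix n * tupleExp t)

theorem prod_setWeight {n : ℕ} (t : Σ j : ℕ, Fin j → Finset (Fin n)) :
    ∏ i, setWeight (t.2 i) = tupleWeight t := by
  simp only [setWeight, tupleWeight, Finset.prod_pow_eq_pow_sum, tupleExp, tupleCard,
    ← Finset.mul_sum, Finset.sum_add_distrib, Finset.sum_const, Finset.card_univ,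
    Fintype.card_fin, smul_eq_mul]
  ring_nf

theorem tupleCard_le {n : ℕ} (t : Σ j : ℕ, Fin j → Finset (Fin n)) : tupleCard t ≤ t.1 * n := by
  refine (Finset.sum_le_card_nsmul _ _ n fun i _ => ?_).trans (by simp)
  simpa using Finset.card_le_univ (t.2 i)

theorem tupleUnion_subset {n : ℕ} {t : Σ j : ℕ, Fin j → Finset (Fin n)} {Y : Finset (Fin n)} :
    tupleUnion t ⊆ Y ↔ ∀ i, t.2 i ⊆ Y := by
  simp [tupleUnion]

/-! ### The recurrences of the two transforms. -/

namespace SetPartitionInstance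
variable {n m s : ℕ} (I : SetPartitionInstance n m s)

/-- The values of the zeta transform of the weights of the parts, after some steps. -/
noncomputable def zetaVal (i : ℕ) (Y : Finset (Fin n)) : ℕ :=
  coverSum I.parts id setWeight (Finset.univ.filter fun x : Fin n => i ≤ x) Y

/-- The values of the Möbius transform of the power sums, after some steps. -/
noncomputable def moebiusVal (i : ℕ) (Y : Finset (Fin n)) : ℕ :=
  coverSum I.tuples tupleUnion tupleWeight (Finset.univ.filter fun x : Fin n => x < i) Y

theorem zetaVal_zero (Y : Finset (Fin n)) :
    I.zetaVal 0 Y = open Classical in if Y ∈ I.parts then setWeight Y else 0 := by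
  simp only [zetaVal, zero_le, Finset.filter_true, coverSum_univ, id, Finset.filter_eq']
  split_ifs <;> simp

theorem filter_le_eq_insert (i : Fin n) : (Finset.univ.filter fun x : Fin n => (i : ℕ) ≤ x) =
    insert i (Finset.univ.filter fun x : Fin n => (i : ℕ) + 1 ≤ x) := by
  ext x
  simp only [Finset.mem_filter, Finset.mem_univ, true_and, Finset.mem_insert, Fin.ext_iff]
  omega

theorem filter_lt_succ_eq_insert (i : Fin n) :
    (Finset.univ.filter fun x : Fin n => (x : ℕ) < i + 1) =
    insert i (Finset.univ.filter fun x : Fin n => (x : ℕ) < i) := by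
  ext x
  simp only [Finset.mem_filter, Finset.mem_univ, true_and, Finset.mem_insert, Fin.ext_iff]
  omega

/-- Here the coordinate `i` leaves the set `C` of exactly prescribed coordinates, so two values are
added. The only other set involved is `Y.erase i`, which is why a downset is all that is needed. -/
theorem zetaVal_succ_of_mem {i : Fin n} {Y : Finset (Fin n)} (h : i ∈ Y) :
    I.zetaVal i Y + I.zetaVal i (Y.erase i) = I.zetaVal (i + 1) Y := by
  simp only [zetaVal, filter_le_eq_insert]
  rw [coverSum_insert_of_notMem _ _ _ _ _ (Finset.notMem_erase i Y),
    coverSum_insert_add _ _ _ _ _ h (by simp)]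

theorem zetaVal_succ_of_notMem {i : Fin n} {Y : Finset (Fin n)} (h : i ∉ Y) :
    I.zetaVal (i + 1) Y = I.zetaVal i Y := by
  simp only [zetaVal, filter_le_eq_insert]
  rw [coverSum_insert_of_notMem _ _ _ _ _ h]

/-- The same identity in the other direction: `i` enters `C`. Every intermediate value is itself a
sum of weights, so the subtractions of the Möbius transform never leave the natural numbers. -/
theorem moebiusVal_succ_of_mem {i : Fin n} {Y : Finset (Fin n)} (h : i ∈ Y) :
    I.moebiusVal (i + 1) Y + I.moebiusVal i (Y.erase i) = I.moebiusVal i Y := by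
  simp only [moebiusVal, filter_lt_succ_eq_insert]
  rw [coverSum_insert_add _ _ _ _ _ h (by simp)]

theorem moebiusVal_succ_of_notMem {i : Fin n} {Y : Finset (Fin n)} (h : i ∉ Y) :
    I.moebiusVal (i + 1) Y = I.moebiusVal i Y := by
  simp only [moebiusVal, filter_lt_succ_eq_insert]
  rw [coverSum_insert_of_notMem _ _ _ _ _ h]

theorem moebiusVal_card (Y : Finset (Fin n)) :
    I.moebiusVal n Y = ∑ t ∈ I.tuples with tupleUnion t = Y, tupleWeight t := by
  simp only [moebiusVal, Fin.is_lt, Finset.filter_true, coverSum_univ]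

/-- The `j`-th power of the sum over the parts inside `Y` expands into the `j`-tuples of such parts,
and weights multiply. Stopping at `n` loses nothing, as at most `n` nonempty sets are disjoint in
`Fin n`. -/
theorem geomSum_zetaVal (Y : Finset (Fin n)) :
    ∑ j ∈ Finset.range (n + 1), I.zetaVal n Y ^ j = I.moebiusVal 0 Y := by
  have h0 : (Finset.univ.filter fun x : Fin n => n ≤ x) = ∅ := by
    ext x; simp
  simp only [zetaVal, moebiusVal, h0, not_lt_zero, Finset.filter_false, coverSum,
    Finset.inter_empty, Finset.empty_subset, and_true, id]
  conv_rhs => rw [Finset.sum_filter, tuples, Finset.sum_sigma]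
  refine Finset.sum_congr rfl fun j _ => ?_
  rw [← Finset.sum_filter, Finset.sum_pow']
  refine Finset.sum_congr ?_ fun t _ => prod_setWeight ⟨j, t⟩
  ext t
  simp only [Fintype.mem_piFinset, Finset.mem_filter, tupleUnion_subset, forall_and]

theorem radix_pos (n : ℕ) : 0 < radix n := by unfold radix; positivity

theorem tupleExp_le {t : Σ j : ℕ, Fin j → Finset (Fin n)} (ht : t ∈ I.tuples) :
    tupleExp t ≤ radix n * n + n * n :=
  Nat.add_le_add (Nat.mul_le_mul_left _ (I.mem_tuples.1 ht).1)
    ((tupleCard_le t).trans (Nat.mul_le_mul_right _ (I.mem_tuples.1 ht).1))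

theorem moebiusVal_le (i : ℕ) (Y : Finset (Fin n)) :
    I.moebiusVal i Y ≤ 2 ^ (n * n + n + radix n * (radix n * n + n * n)) := by
  refine (coverSum_le _ _ _ _ _).trans ?_
  rw [pow_add]
  refine (Finset.sum_le_card_nsmul _ _ (2 ^ (radix n * (radix n * n + n * n)))
    fun t ht => ?_).trans (Nat.mul_le_mul_right _ I.card_tuples_le)
  exact Nat.pow_le_pow_right (by norm_num) (Nat.mul_le_mul_left _ (I.tupleExp_le ht))

theorem zetaVal_le (i : ℕ) (Y : Finset (Fin n)) :
    I.zetaVal i Y ≤ 2 ^ (n + radix n * (radix n + n)) := by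
  refine (coverSum_le _ _ _ _ _).trans ?_
  rw [pow_add]
  refine (Finset.sum_le_card_nsmul _ _ (2 ^ (radix n * (radix n + n)))
    fun t ht => ?_).trans (Nat.mul_le_mul_right _ I.card_parts_le)
  exact Nat.pow_le_pow_right (by norm_num) (Nat.mul_le_mul_left _
    (Nat.add_le_add_left (by simpa using Finset.card_le_univ t) _))

/-! ### Counting the solutions that respect a bipartition. -/

open Classical in
/-- The numbers of empty neighbourhoods that a set partition may use. -/
noncomputable def emptyCounts : Finset ℕ := if I.member ∅ then {0, 1} else {0}

open Classical in
/-- The value in which the solutions that respect the bipartition `Y`, `Yᶜ` are counted. -/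
noncomputable def pairVal (Y : Finset (Fin n)) : ℕ :=
  I.moebiusVal n Y * I.moebiusVal n Yᶜ *
    (1 + (if I.member ∅ then 1 else 0) * 2 ^ (radix n * radix n))

/-- The pairs of tuples with unions `Y` and `Yᶜ`, with a number of empty neighbourhoods. -/
noncomputable def solutions (Y : Finset (Fin n)) :
    Finset (((Σ j : ℕ, Fin j → Finset (Fin n)) × Σ j : ℕ, Fin j → Finset (Fin n)) × ℕ) :=
  ((I.tuples.filter fun t => tupleUnion t = Y) ×ˢ (I.tuples.filter fun t => tupleUnion t = Yᶜ))
    ×ˢ I.emptyCounts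

/-- Expand the product. An empty neighbourhood acts as a part of size 0: it adds one unit of length
and nothing to the total size. -/
theorem pairVal_eq (Y : Finset (Fin n)) : I.pairVal Y =
    ∑ p ∈ I.solutions Y,
      2 ^ (radix n * (tupleExp p.1.1 + tupleExp p.1.2 + radix n * p.2)) := by
  have h : (1 + (open Classical in if I.member ∅ then 1 else 0) * 2 ^ (radix n * radix n))
      = ∑ d ∈ I.emptyCounts, 2 ^ (radix n * (radix n * d)) := by
    unfold emptyCounts
    split_ifs <;> simp
  rw [pairVal, h, moebiusVal_card, moebiusVal_card, Finset.sum_mul_sum, ← Finset.sum_product',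
    Finset.sum_mul_sum, ← Finset.sum_product', solutions]
  refine Finset.sum_congr rfl fun p _ => ?_
  simp only [tupleWeight]
  ring

/-- The choice of `radix` comes from here: two tuples and one bit give at most `2 ^ (2 * (n * n + n)
+ 1)` solutions, and this has to fit below one digit to exclude carries. -/
theorem card_solutions_lt (Y : Finset (Fin n)) : (I.solutions Y).card < 2 ^ radix n := by
  rw [solutions, Finset.card_product, Finset.card_product]
  have h1 : ∀ Z, (I.tuples.filter fun t => tupleUnion t = Z).card ≤ 2 ^ (n * n + n) := fun Z =>
    (Finset.card_filter_le _ _).trans I.card_tuples_le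
  have h2 : I.emptyCounts.card ≤ 2 := by
    unfold emptyCounts
    split_ifs <;> simp
  calc _ ≤ 2 ^ (n * n + n) * 2 ^ (n * n + n) * 2 :=
        Nat.mul_le_mul (Nat.mul_le_mul (h1 _) (h1 _)) h2
    _ = 2 ^ (n * n + n + (n * n + n) + 1) := by rw [← pow_add, ← pow_succ]
    _ < 2 ^ radix n := Nat.pow_lt_pow_right (by norm_num) (by unfold radix; ring_nf; omega)

/-- An exponent that bounds all numbers that occur. -/
def wordBound (n : ℕ) : ℕ :=
  radix n + radix n * (radix n * (2 * n + 3))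

theorem pairVal_lt (Y : Finset (Fin n)) : I.pairVal Y < 2 ^ wordBound n := by
  rw [pairVal_eq]
  refine lt_of_le_of_lt (Finset.sum_le_card_nsmul _ _ (2 ^ (radix n * (radix n * (2 * n + 3))))
    fun p hp => ?_) ?_
  · refine Nat.pow_le_pow_right (by norm_num) (Nat.mul_le_mul_left _ ?_)
    simp only [solutions, Finset.mem_product, Finset.mem_filter] at hp
    obtain ⟨⟨⟨h1, -⟩, h2, -⟩, h3⟩ := hp
    have h1 := I.tupleExp_le h1
    have h2 := I.tupleExp_le h2
    have h3 : p.2 ≤ 1 := by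
      unfold emptyCounts at h3
      split_ifs at h3 <;> simp at h3 <;> omega
    have h4 := Nat.mul_le_mul_left (radix n) h3
    have h5 : n * n + n * n ≤ radix n := by unfold radix; ring_nf; omega
    have : radix n * (2 * n + 3) = radix n * n + radix n * n + radix n + radix n + radix n := by
      ring
    omega
  · rw [smul_eq_mul, wordBound, pow_add]
    exact Nat.mul_lt_mul_of_pos_right (I.card_solutions_lt Y) (by positivity)

/-- Some pair of tuples of parts witnesses a solution of size `s` that respects `Y`, `Yᶜ`. -/
def Splits (Y : Finset (Fin n)) : Prop :=
  ∃ t₁ ∈ I.tuples, ∃ t₂ ∈ I.tuples, ∃ d ∈ I.emptyCounts, tupleUnion t₁ = Y ∧ tupleUnion t₂ = Yᶜ ∧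
    t₁.1 + t₂.1 + d = s ∧ tupleCard t₁ + tupleCard t₂ = n

/-- The digit counts the solutions whose exponent is `radix n * s + n`; what remains is to decode
this exponent into length `s` and total size `n`. -/
theorem digit_pairVal (Y : Finset (Fin n)) :
    I.pairVal Y / 2 ^ (radix n * (radix n * s + n)) % 2 ^ radix n ≠ 0 ↔ I.Splits Y := by
  rw [pairVal_eq, digit_sum_two_pow _ _ _ _ fun j _ =>
    (Finset.card_filter_le _ _).trans_lt (I.card_solutions_lt Y), Finset.card_ne_zero]
  have key : ∀ t₁ ∈ I.tuples, ∀ t₂ ∈ I.tuples, ∀ d,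
      tupleExp t₁ + tupleExp t₂ + radix n * d = radix n * s + n ↔
        t₁.1 + t₂.1 + d = s ∧ tupleCard t₁ + tupleCard t₂ = n := by
    intro t₁ h₁ t₂ h₂ d
    have h1 := (tupleCard_le t₁).trans (Nat.mul_le_mul_right _ (I.mem_tuples.1 h₁).1)
    have h2 := (tupleCard_le t₂).trans (Nat.mul_le_mul_right _ (I.mem_tuples.1 h₂).1)
    -- Each total size is at most `n * n`, so their sum is below `radix n`, and division with
    -- remainder by `radix n` separates it from the length.
    have h5 : n * n + n * n + n < radix n := by unfold radix; ring_nf; omega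
    have e1 : tupleExp t₁ + tupleExp t₂ + radix n * d
        = (tupleCard t₁ + tupleCard t₂) + radix n * (t₁.1 + t₂.1 + d) := by
      unfold tupleExp; ring
    rw [e1, add_comm (radix n * s)]
    constructor
    · intro h
      have hd := congrArg (· / radix n) h
      have hm := congrArg (· % radix n) h
      simp only [Nat.add_mul_div_left _ _ (radix_pos n), Nat.add_mul_mod_self_left] at hd hm
      rw [Nat.div_eq_of_lt (by omega), Nat.div_eq_of_lt (by omega)] at hd
      rw [Nat.mod_eq_of_lt (by omega), Nat.mod_eq_of_lt (by omega)] at hm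
      omega
    · rintro ⟨h, h'⟩
      rw [h, h']
  constructor
  · rintro ⟨⟨⟨t₁, t₂⟩, d⟩, h⟩
    simp only [solutions, Finset.mem_filter, Finset.mem_product] at h
    obtain ⟨⟨⟨⟨h1, u1⟩, h2, u2⟩, hd⟩, h⟩ := h
    exact ⟨t₁, h1, t₂, h2, d, hd, u1, u2, (key t₁ h1 t₂ h2 d).1 h⟩
  · rintro ⟨t₁, h1, t₂, h2, d, hd, u1, u2, h⟩
    refine ⟨⟨⟨t₁, t₂⟩, d⟩, ?_⟩
    simp only [solutions, Finset.mem_filter, Finset.mem_product]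
    exact ⟨⟨⟨⟨h1, u1⟩, h2, u2⟩, hd⟩, (key t₁ h1 t₂ h2 d).2 h⟩

/-! ### Solutions versus set partitions. -/

theorem pairwise_disjoint_of_sum_card {ι : Type*} [Fintype ι] [DecidableEq ι]
    (t : ι → Finset (Fin n))
    (hu : Finset.univ.biUnion t = Finset.univ) (hc : ∑ i, (t i).card = n) (i j : ι)
    (hij : i ≠ j) : Disjoint (t i) (t j) := by
  -- Double counting: the multiplicities of the `n` points sum to `n`, and each is at least 1 by the
  -- covering, so each equals 1.
  have h1 : ∑ x : Fin n, (Finset.univ.filter fun i => x ∈ t i).card = ∑ x : Fin n, 1 := by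
    simp only [Finset.card_filter]
    rw [Finset.sum_comm]
    simp only [← Finset.card_filter, Finset.filter_mem_eq_inter, Finset.univ_inter, hc]
    simp
  have h2 : ∀ x ∈ (Finset.univ : Finset (Fin n)),
      1 ≤ (Finset.univ.filter fun i => x ∈ t i).card := by
    intro x _
    have : x ∈ Finset.univ.biUnion t := hu ▸ Finset.mem_univ x
    obtain ⟨i, -, hi⟩ := Finset.mem_biUnion.1 this
    exact Finset.card_pos.2 ⟨i, by simpa using hi⟩
  have h3 := (Finset.sum_eq_sum_iff_of_le h2).1 h1.symm
  rw [Finset.disjoint_left]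
  intro x hi hj
  exact hij (Finset.card_le_one.1 (h3 x (Finset.mem_univ x)).ge i (by simpa using hi) j
    (by simpa using hj))

theorem hasSetPartition_of_splits {Y : Finset (Fin n)} (h : I.Splits Y) : I.HasSetPartition := by
  classical
  obtain ⟨⟨j₁, t₁⟩, h1, ⟨j₂, t₂⟩, h2, d, hd, u1, u2, hs, hc⟩ := h
  have h1 := (I.mem_tuples.1 h1).2
  have h2 := (I.mem_tuples.1 h2).2
  simp only [tupleUnion, tupleCard] at h1 h2 u1 u2 hc hs
  set t : Fin j₁ ⊕ Fin j₂ → Finset (Fin n) := Sum.elim t₁ t₂ with ht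
  have hne : ∀ i, t i ≠ ∅ := by rintro (i | i); exacts [(h1 i).2, (h2 i).2]
  have hmem : ∀ i, I.member (t i) := by rintro (i | i); exacts [(h1 i).1, (h2 i).1]
  choose f hf using hmem
  have hu : Finset.univ.biUnion t = Finset.univ := by
    refine Finset.eq_univ_of_forall fun x => ?_
    by_cases hx : x ∈ Y
    · rw [← u1] at hx
      obtain ⟨i, -, hi⟩ := Finset.mem_biUnion.1 hx
      exact Finset.mem_biUnion.2 ⟨.inl i, Finset.mem_univ _, hi⟩
    · rw [← Finset.mem_compl, ← u2] at hx
      obtain ⟨i, -, hi⟩ := Finset.mem_biUnion.1 hx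
      exact Finset.mem_biUnion.2 ⟨.inr i, Finset.mem_univ _, hi⟩
  have hdis := pairwise_disjoint_of_sum_card t hu (by simpa [ht] using hc)
  -- Two positions with the same vertex would carry the same nonempty set, which is not disjoint
  -- from itself.
  have hinj : Function.Injective f := by
    intro i j hij
    by_contra hne'
    have := hdis i j hne'
    rw [← hf i, ← hf j, hij, disjoint_self] at this
    exact hne j ((hf j).symm.trans this)
  have hcard : (Finset.univ.image f).card = j₁ + j₂ := by
    rw [Finset.card_image_of_injective _ hinj]; simp
  have hnb : I.nbhd (Finset.univ.image f) = Finset.univ := by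
    rw [← hu, nbhd, Finset.image_biUnion]
    simp only [hf]
  have hD : ∀ a ∈ Finset.univ.image f, ∀ b ∈ Finset.univ.image f, a ≠ b →
      Disjoint (I.N a) (I.N b) := by
    intro a ha b hb hab
    obtain ⟨i, -, rfl⟩ := Finset.mem_image.1 ha
    obtain ⟨j, -, rfl⟩ := Finset.mem_image.1 hb
    rw [hf, hf]
    exact hdis i j fun h => hab (h ▸ rfl)
  -- For `d = 1` a vertex with empty neighbourhood is added; it changes neither the union nor
  -- disjointness.
  by_cases h0 : d = 0
  · exact ⟨Finset.univ.image f, hnb, by rw [hcard]; omega, hD⟩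
  · unfold emptyCounts at hd
    split_ifs at hd with hE
    · obtain ⟨e, he⟩ := hE
      have he' : e ∉ Finset.univ.image f := by
        intro hmem
        obtain ⟨i, -, rfl⟩ := Finset.mem_image.1 hmem
        exact hne i ((hf i).symm.trans he)
      refine ⟨insert e (Finset.univ.image f), ?_, ?_, ?_⟩
      · rw [nbhd, Finset.biUnion_insert, he, Finset.empty_union]; exact hnb
      · rw [Finset.card_insert_of_notMem he', hcard]
        simp at hd; omega
      · intro a ha b hb hab
        rw [Finset.mem_insert] at ha hb
        rcases ha with rfl | ha
        · simp [he]
        rcases hb with rfl | hb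
        · simp [he]
        exact hD a ha b hb hab
    · simp at hd; omega

/-- Drop the empty neighbourhoods, which the last equation counts separately. Each remaining one
contributes at least 1 to the sum, so at most `n` remain. -/
theorem exists_tuple (S : Finset (Fin m)) (hS : ∑ f ∈ S, (I.N f).card ≤ n) :
    ∃ t ∈ I.tuples, tupleUnion t = I.nbhd S ∧ tupleCard t = ∑ f ∈ S, (I.N f).card ∧
      t.1 + (S.filter fun f => I.N f = ∅).card = S.card := by
  classical
  set S' := S.filter fun f => I.N f ≠ ∅ with hS'
  have hsum : ∑ f ∈ S', (I.N f).card = ∑ f ∈ S, (I.N f).card :=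
    Finset.sum_filter_of_ne fun f _ h h0 => h (by simp [h0])
  have hle : S'.card ≤ n := by
    refine le_trans ?_ (hsum.trans_le hS)
    rw [Finset.card_eq_sum_ones]
    exact Finset.sum_le_sum fun f hf => Finset.card_pos.2
      (Finset.nonempty_iff_ne_empty.2 (Finset.mem_filter.1 hf).2)
  refine ⟨⟨S'.card, fun i => I.N (S'.equivFin.symm i)⟩, I.mem_tuples.2 ⟨hle, fun i => ⟨⟨_, rfl⟩,
    (Finset.mem_filter.1 (S'.equivFin.symm i).2).2⟩⟩, ?_, ?_, ?_⟩
  · ext x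
    simp only [tupleUnion, nbhd, Finset.mem_biUnion, Finset.mem_univ, true_and]
    constructor
    · rintro ⟨i, hi⟩
      exact ⟨_, (Finset.mem_filter.1 (S'.equivFin.symm i).2).1, hi⟩
    · rintro ⟨f, hf, hx⟩
      refine ⟨S'.equivFin ⟨f, Finset.mem_filter.2 ⟨hf, fun h => by simp [h] at hx⟩⟩, ?_⟩
      simpa using hx
  · rw [← hsum, tupleCard, ← Finset.sum_coe_sort S']
    exact Equiv.sum_comp S'.equivFin.symm fun f : S' => (I.N f).card
  · rw [add_comm]
    exact Finset.card_filter_add_card_filter_not (s := S) (fun f => I.N f = ∅)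

/-- List the nonempty neighbourhoods of `S₁` and `S₂` as tuples. At most one empty neighbourhood is
left over, which is what `emptyCounts` provides for; the same count gives the bound on `s` that the
algorithm tests at the start. -/
theorem splits_of_isWitnessHalve {β : ℝ} {W : Finset (Fin n)} (hI : I.AtMostOneEmpty)
    (h : I.IsWitnessHalve β W) : I.Splits W ∧ s ≤ n + 1 := by
  classical
  obtain ⟨-, S₁, S₂, hdis, hu, hc, h1, h2, hs⟩ := h
  rw [Finset.sum_union hdis] at hc
  obtain ⟨t₁, m1, u1, c1, l1⟩ := I.exists_tuple S₁ (by omega)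
  obtain ⟨t₂, m2, u2, c2, l2⟩ := I.exists_tuple S₂ (by omega)
  have hcard : ((S₁ ∪ S₂).filter fun f => I.N f = ∅).card =
      (S₁.filter fun f => I.N f = ∅).card + (S₂.filter fun f => I.N f = ∅).card := by
    rw [Finset.filter_union, Finset.card_union_of_disjoint]
    exact Finset.disjoint_filter_filter hdis
  have hle : ((S₁ ∪ S₂).filter fun f => I.N f = ∅).card ≤ 1 :=
    Finset.card_le_one.2 fun a ha b hb =>
      hI a b (Finset.mem_filter.1 ha).2 (Finset.mem_filter.1 hb).2
  have hlen : ∀ t ∈ I.tuples, t.1 ≤ tupleCard t := by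
    intro t ht
    have := Finset.card_nsmul_le_sum Finset.univ (fun i => (t.2 i).card) 1 fun i _ =>
      Finset.card_pos.2 (Finset.nonempty_iff_ne_empty.2 ((I.mem_tuples.1 ht).2 i).2)
    simpa [tupleCard] using this
  refine ⟨⟨t₁, m1, t₂, m2, ((S₁ ∪ S₂).filter fun f => I.N f = ∅).card, ?_, by rw [u1, h1],
    by rw [u2, h2], by omega, by omega⟩, ?_⟩
  · unfold emptyCounts
    split_ifs with hE
    · simp only [Finset.mem_insert, Finset.mem_singleton]; omega
    · rw [Finset.mem_singleton, Finset.card_eq_zero]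
      exact Finset.filter_false_of_mem fun f _ h => hE ⟨f, h⟩
  · have := hlen t₁ m1
    have := hlen t₂ m2
    omega

end SetPartitionInstance

namespace WordRAM
variable {n : ℕ} {E : Env n}

open SetPartitionInstance (wordBound radix_pos)

/-! ### Representation of a list of sets with values in the memory -/

/-- The memory holds the list `L` of sets, and the value `V Y` for every set `Y`. -/
structure Rep (L : List (Finset (Fin n))) (V : Finset (Fin n) → ℕ) (σ : State) : Prop where
  flag : ∀ Y, σ.mem (3 * bits Y + 0) = if Y ∈ L then 1 else 0
  list : ∀ i (h : i < L.length), σ.mem (3 * i + 1) = bits L[i]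
  val : ∀ Y, σ.mem (3 * bits Y + 2) = V Y
  len : σ.var 7 = L.length

/-- The variables `0` to `6` hold the parameters of the algorithm. -/
structure Par (n s M β : ℕ) (σ : State) : Prop where
  v0 : σ.var 0 = n
  v1 : σ.var 1 = s
  v2 : σ.var 2 = M
  v3 : σ.var 3 = β
  v4 : σ.var 4 = radix n
  v5 : σ.var 5 = radix n * radix n
  v6 : σ.var 6 + 1 = 2 ^ n

section rep
variable {L : List (Finset (Fin n))} {V : Finset (Fin n) → ℕ} {σ σ' : State} {s M β : ℕ}

theorem Rep.congr (h : Rep L V σ) (hm : σ'.mem = σ.mem) (h7 : σ'.var 7 = σ.var 7) : Rep L V σ' :=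
  ⟨by simpa [hm] using h.flag, by simpa [hm] using h.list, by simpa [hm] using h.val,
    by rw [h7, h.len]⟩

theorem Rep.setVar (h : Rep L V σ) {x : ℕ} (hx : 7 < x) (v : ℕ) : Rep L V (σ.setVar x v) :=
  h.congr rfl (by simp [hx.ne])

/-- Flags, list entries and values are three arrays interleaved modulo 3, so writing to one does not
disturb the others. -/
theorem Rep.setVal (h : Rep L V σ) (Y : Finset (Fin n)) (v : ℕ) :
    Rep L (Function.update V Y v) (σ.setMem (3 * bits Y + 2) v) := by
  refine ⟨fun Z => ?_, fun i hi => ?_, fun Z => ?_, h.len⟩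
  · rw [State.setMem_mem, if_neg (by omega), h.flag]
  · rw [State.setMem_mem, if_neg (by omega), h.list]
  · simp [State.setMem_mem, h.val, Function.update_apply]

theorem Rep.push (h : Rep L V σ) (X : Finset (Fin n)) :
    Rep (L ++ [X]) V (((σ.setMem (3 * bits X + 0) 1).setMem (3 * L.length + 1) (bits X)).setVar 7
      (L.length + 1)) := by
  refine ⟨fun Z => ?_, fun i hi => ?_, fun Z => ?_, by simp⟩
  · rw [State.setVar_mem, State.setMem_mem, if_neg (by omega), State.setMem_mem, h.flag]
    by_cases hZ : Z = X
    · simp [hZ]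
    · simp [hZ]
  · rw [State.setVar_mem, State.setMem_mem, State.setMem_mem, if_neg (c := _ = 3 * bits X + 0) (by omega)]
    have hi' := hi
    rw [List.length_append, List.length_singleton] at hi'
    by_cases hi'' : i = L.length
    · subst hi''; simp
    · rw [if_neg (by omega), h.list i (by omega), List.getElem_append_left]
  · rw [State.setVar_mem, State.setMem_mem, if_neg (by omega), State.setMem_mem,
      if_neg (by omega), h.val]

theorem Par.congr (h : Par n s M β σ) (hv : ∀ i < 7, σ'.var i = σ.var i) : Par n s M β σ' := by
  obtain ⟨h0, h1, h2, h3, h4, h5, h6⟩ := h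
  exact ⟨by rw [hv _ (by omega), h0], by rw [hv _ (by omega), h1], by rw [hv _ (by omega), h2],
    by rw [hv _ (by omega), h3], by rw [hv _ (by omega), h4], by rw [hv _ (by omega), h5],
    by rw [hv _ (by omega), h6]⟩

theorem Par.setVar (h : Par n s M β σ) {x : ℕ} (hx : 7 ≤ x) (v : ℕ) : Par n s M β (σ.setVar x v) :=
  h.congr fun i hi => by rw [State.setVar_var, if_neg (by omega)]

theorem Par.setMem (h : Par n s M β σ) (a v : ℕ) : Par n s M β (σ.setMem a v) :=
  h.congr fun _ _ => rfl

theorem length_le_two_pow (hL : L.Nodup) : L.length ≤ 2 ^ n := by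
  classical
  rw [← List.toFinset_card_of_nodup hL]
  exact (Finset.card_le_univ _).trans (by simp)

end rep

/-! ### Expressions and bounds -/

/-- The address `3 * e + r`. -/
def Expr.tri (e : Expr) (r : ℕ) : Expr := .bin .add (.bin .mul (.const 3) e) (.const r)

/-- The binary digit of `e` at position `i`. -/
def Expr.bit (e i : Expr) : Expr := .bin .land (.bin .shr e i) (.const 1)

/-- `e` without its binary digit at position `i`, which has to be `1`. -/
def Expr.clear (e i : Expr) : Expr := .bin .sub e (.bin .shl (.const 1) i)

/-- There is no empty command; variable `14` is scratch wherever this one occurs. -/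
def Cmd.skip : Cmd := .assign 14 (.const 0)

section bounds
variable {w : ℕ}

/-- The factor 64 is headroom for addresses `3 * bits Y + 2` and small sums, so that `omega` can
exclude overflow. -/
theorem two_pow_mul_le (hw : wordBound n + 100 ≤ w) : 64 * 2 ^ n ≤ 2 ^ w := by
  rw [show 64 = 2 ^ 6 by norm_num, ← pow_add]
  refine Nat.pow_le_pow_right (by norm_num) (le_trans ?_ hw)
  have h1 := radix_pos n
  have h2 : n ≤ radix n := by unfold radix; ring_nf; omega
  unfold wordBound
  omega

theorem radix_facts (n : ℕ) : n < radix n ∧ radix n ≤ wordBound n ∧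
    radix n * radix n ≤ wordBound n ∧ radix n * (radix n + n) ≤ wordBound n ∧
    ∀ s ≤ n + 1, radix n * (radix n * s + n) ≤ wordBound n := by
  have h2 : n < radix n := by unfold radix; ring_nf; omega
  have h3 : ∀ s ≤ n + 1, radix n * (radix n * s + n) ≤ wordBound n := by
    intro s hs
    unfold wordBound
    refine le_trans (Nat.mul_le_mul_left _ ?_) (Nat.le_add_left _ _)
    have := Nat.mul_le_mul_left (radix n) hs
    have e : radix n * (2 * n + 3) = radix n * (n + 1) + radix n * (n + 1) + radix n := by ring
    omega
  refine ⟨h2, by unfold wordBound; omega, le_trans ?_ (h3 1 (by omega)), ?_, h3⟩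
  · exact Nat.mul_le_mul_left _ (by omega)
  · simpa using h3 1 (by omega)

variable {σ : State} {e i : Expr}

theorem eval_tri {x r : ℕ} (he : e.eval w σ = x) (hr : r < 3) (h : 3 * x + 3 < 2 ^ w) :
    (e.tri r).eval w σ = 3 * x + r :=
  eval_add (eval_mul (eval_const (by omega)) he (by omega)) (eval_const (by omega)) (by omega)

theorem eval_bit {Y : Finset (Fin n)} {k : Fin n} (h : 64 * 2 ^ n ≤ 2 ^ w)
    (he : e.eval w σ = bits Y) (hi : i.eval w σ = k) :
    (e.bit i).eval w σ = if k ∈ Y then 1 else 0 := by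
  have hY := bits_lt Y
  refine (eval_land_mask (y := 1) (eval_shr he hi (by omega)) (eval_const (by omega)) ?_).trans
    (bits_div_mod Y k)
  exact (Nat.div_le_self _ _).trans_lt (by omega)

theorem eval_clear {Y : Finset (Fin n)} {k : Fin n} (h : 64 * 2 ^ n ≤ 2 ^ w) (hk : k ∈ Y)
    (he : e.eval w σ = bits Y) (hi : i.eval w σ = k) :
    (e.clear i).eval w σ = bits (Y.erase k) := by
  have hY := bits_lt Y
  have hc := bits_erase_add hk
  exact (eval_sub he (eval_shl (eval_const (by omega)) hi (by omega)) (by omega) (by omega)).trans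
    (by omega)

end bounds

theorem Runs.skip {σ : State} {Q : State → Prop} (hQ : Q (σ.setVar 14 0)) :
    Runs E .skip σ 2 Q := .assign 0 (by simp [Expr.eval]) hQ

theorem nodup_length_lt {L : List (Finset (Fin n))} (hL : L.Nodup) {X : Finset (Fin n)}
    (hX : X ∉ L) : L.length < 2 ^ n := by
  have := length_le_two_pow (hL.cons hX)
  simpa using this

/-! ### Adding a set to the list -/

/-- Append the set in variable `15` to the list, unless it is a member already. -/
def Cmd.push : Cmd :=
  .ite (.load (.tri (.var 15) 0)) .skip
    (.seq (.store (.tri (.var 15) 0) (.const 1)) (.seq (.store (.tri (.var 7) 1) (.var 15))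
      (.assign 7 (.bin .add (.var 7) (.const 1)))))

/-- The flag makes the membership test constant time. That the old list is a prefix of the new one
lets a scan of the list continue while it grows. -/
theorem runs_push {L : List (Finset (Fin n))} {V : Finset (Fin n) → ℕ} {σ : State}
    {X : Finset (Fin n)} (hw : 64 * 2 ^ n ≤ 2 ^ E.w) (hR : Rep L V σ) (hL : L.Nodup)
    (hX : σ.var 15 = bits X) :
    Runs E .push σ 100 fun σ' => (∃ L' : List (Finset (Fin n)), L'.Nodup ∧ L <+: L' ∧
      (∀ Y, Y ∈ L' ↔ Y ∈ L ∨ Y = X) ∧ Rep L' V σ') ∧ σ'.flips = σ.flips ∧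
      ∀ i, i ≠ 7 → i ≠ 14 → σ'.var i = σ.var i := by
  have hb := bits_lt X
  have hflag : (Expr.load (.tri (.var 15) 0)).eval E.w σ = if X ∈ L then 1 else 0 :=
    eval_load (eval_tri (eval_var _ hX) (by omega) (by omega)) (hR.flag X)
  -- The first goal leaves the time bound open, to be assembled by unification from the rules; the
  -- second compares it with the stated bound.
  apply Runs.within
  · apply Runs.ite
    · intro h
      apply Runs.skip
      rw [hflag] at h
      have hX : X ∈ L := by by_contra hX; simp [hX] at h
      refine ⟨⟨L, hL, List.prefix_rfl, fun Y => ?_, hR.setVar (by omega) _⟩, rfl, fun i _ hi => ?_⟩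
      · exact ⟨Or.inl, fun h => h.elim id fun h => h ▸ hX⟩
      · simp [hi]
    · intro h
      rw [hflag] at h
      have hX' : X ∉ L := by intro hX; simp [hX] at h
      have hlen := nodup_length_lt hL hX'
      have h7 := hR.len
      refine .seq (.store (3 * bits X + 0) 1 (eval_tri (eval_var _ hX) (by omega) (by omega))
        (eval_const (by omega)) (.seq (.store (3 * L.length + 1) (bits X)
        (eval_tri (eval_var _ h7) (by omega) (by omega)) (eval_var _ hX)
        (.assign (L.length + 1) (eval_add (eval_var _ h7) (eval_const (by omega)) (by omega)) ?_))))
      refine ⟨⟨L ++ [X], ?_, List.prefix_append _ _, fun Y => by simp, hR.push X⟩, rfl,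
        fun i hi _ => by simp [hi]⟩
      exact hL.append (List.nodup_singleton _) (by simpa using hX')
  · simp [Expr.cost, Expr.tri]

/-! ### Sampling -/

/-- The random set that is read off the coin tosses from number `b` on. -/
def coinSet (n : ℕ) (coin : ℕ → Bool) (b : ℕ) : Finset (Fin n) :=
  Finset.univ.filter fun i => coin (b + i) = true

/-- The sizes of `X` and of its complement differ by at most `β`. -/
def Balanced (β : ℕ) (X : Finset (Fin n)) : Prop :=
  2 * X.card ≤ n + β ∧ n ≤ 2 * X.card + β

def Cmd.tossSet : Cmd :=
  .forUpto 11 0 (.seq (.flip 14) (.seq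
    (.assign 12 (.bin .add (.var 12) (.bin .shl (.var 14) (.var 11))))
    (.assign 13 (.bin .add (.var 13) (.var 14)))))

def Cmd.sampleOnce : Cmd :=
  .seq (.assign 12 (.const 0)) (.seq (.assign 13 (.const 0)) (.seq .tossSet
    (.ite (.bin .lt (.bin .add (.var 0) (.var 3)) (.bin .add (.var 13) (.var 13))) .skip
      (.ite (.bin .lt (.bin .add (.bin .add (.var 13) (.var 13)) (.var 3)) (.var 0)) .skip
        (.seq (.assign 15 (.var 12)) (.seq .push
          (.seq (.assign 15 (.bin .sub (.var 6) (.var 12))) .push)))))))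

def Cmd.sample : Cmd := .forUpto 10 2 .sampleOnce

theorem bits_filter_succ (X : Finset (Fin n)) (k : ℕ) (hk : k < n) :
    bits (X.filter fun i : Fin n => (i : ℕ) < k + 1) = bits (X.filter fun i : Fin n => (i : ℕ) < k) +
      (decide ((⟨k, hk⟩ : Fin n) ∈ X)).toNat * 2 ^ k ∧
    (X.filter fun i : Fin n => (i : ℕ) < k + 1).card = (X.filter fun i : Fin n => (i : ℕ) < k).card +
      (decide ((⟨k, hk⟩ : Fin n) ∈ X)).toNat := by
  by_cases h : (⟨k, hk⟩ : Fin n) ∈ X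
  · have e : (X.filter fun i : Fin n => (i : ℕ) < k + 1) =
        insert ⟨k, hk⟩ (X.filter fun i : Fin n => (i : ℕ) < k) := by
      ext i
      simp only [Finset.mem_filter, Finset.mem_insert, Fin.ext_iff]
      constructor
      · rintro ⟨h1, h2⟩
        by_cases h3 : (i : ℕ) = k
        · exact .inl h3
        · exact .inr ⟨h1, by omega⟩
      · rintro (h1 | ⟨h1, h2⟩)
        · have : i = ⟨k, hk⟩ := Fin.ext h1
          exact ⟨this ▸ h, by omega⟩
        · exact ⟨h1, by omega⟩
    rw [e, Finset.card_insert_of_notMem (by simp), bits, Finset.sum_insert (by simp)]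
    simp [h, bits, add_comm]
  · have e : (X.filter fun i : Fin n => (i : ℕ) < k + 1) = (X.filter fun i : Fin n => (i : ℕ) < k) := by
      ext i
      simp only [Finset.mem_filter, and_congr_right_iff]
      intro h1
      have : (i : ℕ) ≠ k := fun h2 => h ((Fin.ext h2 : i = ⟨k, hk⟩) ▸ h1)
      omega
    rw [e]
    simp [h]

/-- Pass `k` decides the membership of `k`. Exactly `n` coins are used, whatever they show, which is
why sample number `k` starts at coin `k * n`. -/
theorem runs_tossSet {L : List (Finset (Fin n))} {V : Finset (Fin n) → ℕ} {σ : State} {s M β : ℕ}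
    (hw : 64 * 2 ^ n ≤ 2 ^ E.w) (hR : Rep L V σ) (hP : Par n s M β σ) (h12 : σ.var 12 = 0)
    (h13 : σ.var 13 = 0) :
    Runs E .tossSet σ (50 * (n + 1)) fun σ' => Rep L V σ' ∧ Par n s M β σ' ∧
      σ'.var 12 = bits (coinSet n E.coin σ.flips) ∧ σ'.var 13 = (coinSet n E.coin σ.flips).card ∧
      σ'.var 10 = σ.var 10 ∧ σ'.flips = σ.flips + n := by
  have hn : n < 2 ^ n := Nat.lt_two_pow_self
  have hw0 : 0 < E.w := by
    by_contra h
    have : E.w = 0 := by omega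
    rw [this] at hw
    omega
  set X := coinSet n E.coin σ.flips with hX
  apply Runs.within
  · apply Runs.forUpto n (fun k σ' => Rep L V σ' ∧ Par n s M β σ' ∧
      σ'.var 12 = bits (X.filter fun i : Fin n => (i : ℕ) < k) ∧
      σ'.var 13 = (X.filter fun i : Fin n => (i : ℕ) < k).card ∧
      σ'.var 10 = σ.var 10 ∧ σ'.flips = σ.flips + k) (by omega) hw0
    · exact ⟨hR.setVar (by omega) _, hP.setVar (by omega) _, by simp [h12], by simp [h13], by simp,
        by simp⟩
    · exact fun k σ h => h.2.1.v0
    · rintro k σ' hk h11 ⟨hR, hP, h12, h13, h10, hf⟩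
      obtain ⟨e1, e2⟩ := bits_filter_succ X k hk
      have hc : decide ((⟨k, hk⟩ : Fin n) ∈ X) = E.coin σ'.flips := by
        simp [hX, coinSet, hf]
      have hb := bits_lt (X.filter fun i : Fin n => (i : ℕ) < k + 1)
      have hcd : (X.filter fun i : Fin n => (i : ℕ) < k + 1).card ≤ n := by
        simpa using Finset.card_le_univ (X.filter fun i : Fin n => (i : ℕ) < k + 1)
      rw [hc] at e1 e2
      refine .seq (.flip hw0 (.seq (.assign _ (eval_add (eval_var _ (by simpa using h12))
        (eval_shl (eval_var (x := (E.coin σ'.flips).toNat) _ (by simp))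
        (eval_var _ (by simpa using h11)) (by omega)) (by omega))
        (.assign _ (eval_add (eval_var _ (by simpa using h13))
          (eval_var (x := (E.coin σ'.flips).toNat) _ (by simp))
          (by omega)) ?_))))
      refine ⟨by simpa using h11, hR.congr (by simp) (by simp), hP.congr fun i hi => ?_, ?_, ?_, ?_,
        ?_⟩
      · simp [show i ≠ 11 by omega, show i ≠ 12 by omega, show i ≠ 13 by omega,
          show i ≠ 14 by omega]
      · rw [e1]; simp
      · rw [e2]; simp
      · simpa using h10
      · simp [hf, add_assoc]
    · rintro σ' ⟨hR, hP, h12, h13, h10, hf⟩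
      simp only [Fin.is_lt, Finset.filter_true] at h12 h13
      exact ⟨hR, hP, h12, h13, h10, hf⟩
  · simp only [Expr.cost]; omega

theorem runs_sampleOnce {L : List (Finset (Fin n))} {V : Finset (Fin n) → ℕ} {σ : State}
    {s M β : ℕ} (hw : 64 * 2 ^ n ≤ 2 ^ E.w) (hR : Rep L V σ) (hL : L.Nodup)
    (hP : Par n s M β σ) (hβ : β ≤ 2 * n) :
    Runs E .sampleOnce σ (1000 * (n + 1)) fun σ' => (∃ L' : List (Finset (Fin n)), L'.Nodup ∧
      (∀ Y, Y ∈ L' ↔ Y ∈ L ∨ (Balanced β (coinSet n E.coin σ.flips) ∧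
        (Y = coinSet n E.coin σ.flips ∨ Y = (coinSet n E.coin σ.flips)ᶜ))) ∧ Rep L' V σ') ∧
      Par n s M β σ' ∧ σ'.var 10 = σ.var 10 ∧ σ'.flips = σ.flips + n := by
  have hn : n < 2 ^ n := Nat.lt_two_pow_self
  have hw0 : 0 < E.w := by
    by_contra h
    have : E.w = 0 := by omega
    rw [this] at hw
    omega
  set X := coinSet n E.coin σ.flips with hX
  have hXc : X.card ≤ n := by simpa using Finset.card_le_univ X
  apply Runs.within
  · apply Runs.seq
    apply Runs.assign 0 (eval_const (by omega))
    apply Runs.seq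
    apply Runs.assign 0 (eval_const (by omega))
    apply Runs.seq
    refine (runs_tossSet hw ((hR.setVar (by omega) _).setVar (by omega) _)
        ((hP.setVar (by omega) _).setVar (by omega) _) (by simp) (by simp)).mono le_rfl ?_
    rintro σ' ⟨hR, hP, h12, h13, h10, hf⟩
    simp only [State.setVar_flips, State.setVar_var] at h12 h13 h10 hf
    rw [if_neg (by omega), if_neg (by omega)] at h10
    rw [← hX] at h12 h13
    have ev1 : (Expr.bin .lt (.bin .add (.var 0) (.var 3)) (.bin .add (.var 13) (.var 13))).eval
        E.w σ' = if n + β < X.card + X.card then 1 else 0 :=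
      eval_lt hw0 (eval_add (eval_var _ hP.v0) (eval_var _ hP.v3) (by omega))
        (eval_add (eval_var _ h13) (eval_var _ h13) (by omega))
    have ev2 : (Expr.bin .lt (.bin .add (.bin .add (.var 13) (.var 13)) (.var 3)) (.var 0)).eval
        E.w σ' = if X.card + X.card + β < n then 1 else 0 :=
      eval_lt hw0 (eval_add (eval_add (eval_var _ h13) (eval_var _ h13) (by omega))
        (eval_var _ hP.v3) (by omega)) (eval_var _ hP.v0)
    apply Runs.ite
    · intro h
      apply Runs.skip
      rw [ev1] at h
      have hB : ¬ Balanced β X := fun hB => h (if_neg (by have := hB.1; omega))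
      exact ⟨⟨L, hL, by simp [hB], hR.setVar (by omega) _⟩, hP.setVar (by omega) _,
        by simpa using h10, hf⟩
    intro h
    apply Runs.ite
    · intro h'
      apply Runs.skip
      rw [ev2] at h'
      have hB : ¬ Balanced β X := fun hB => h' (if_neg (by have := hB.2; omega))
      exact ⟨⟨L, hL, by simp [hB], hR.setVar (by omega) _⟩, hP.setVar (by omega) _,
        by simpa using h10, hf⟩
    · intro h'
      rw [ev1] at h
      rw [ev2] at h'
      have hB : Balanced β X := by
        constructor
        · by_contra hc
          rw [if_pos (by omega)] at h
          omega
        · by_contra hc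
          rw [if_pos (by omega)] at h'
          omega
      apply Runs.seq
      apply Runs.assign _ (eval_var _ h12)
      apply Runs.seq
      refine (runs_push (X := X) hw (hR.setVar (by omega) _) hL (by simp)).mono le_rfl ?_
      rintro σ₁ ⟨⟨L₁, hL₁, -, hm₁, hR₁⟩, hf₁, hv₁⟩
      have hP₁ : Par n s M β σ₁ := (hP.setVar (x := 15) (by omega) (bits X)).congr
        fun i hi => hv₁ i (by omega) (by omega)
      have h12₁ : σ₁.var 12 = bits X := by
        rw [hv₁ _ (by omega) (by omega)]; simpa using h12
      have hcompl := bits_compl X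
      have h6 := hP₁.v6
      -- Variable `6` is the word of the full set, so this subtraction complements.
      have ev3 : (Expr.bin .sub (.var 6) (.var 12)).eval E.w σ₁ = bits Xᶜ :=
        (eval_sub (eval_var _ rfl) (eval_var _ h12₁) (by omega) (by omega)).trans (by omega)
      refine .seq (.assign _ ev3
        ((runs_push (X := Xᶜ) hw (hR₁.setVar (by omega) _) hL₁ (by simp)).mono le_rfl ?_))
      rintro σ₂ ⟨⟨L₂, hL₂, -, hm₂, hR₂⟩, hf₂, hv₂⟩
      refine ⟨⟨L₂, hL₂, fun Y => ?_, hR₂⟩, (hP₁.setVar (x := 15) (by omega) (bits Xᶜ)).congr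
        fun i hi => hv₂ i (by omega) (by omega), ?_, ?_⟩
      · simp [hm₂, hm₁, hB, or_assoc]
      · rw [hv₂ _ (by omega) (by omega), State.setVar_var, if_neg (by omega),
          hv₁ _ (by omega) (by omega), State.setVar_var, if_neg (by omega), h10]
      · rw [hf₂, State.setVar_flips, hf₁, State.setVar_flips, hf]
  · simp only [Expr.cost]; omega

theorem runs_sample {σ : State} {s M β : ℕ} (hw : 64 * 2 ^ n ≤ 2 ^ E.w)
    (hR : Rep ([] : List (Finset (Fin n))) (fun _ => 0) σ) (hP : Par n s M β σ) (hβ : β ≤ 2 * n)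
    (hM : M ≤ 2 ^ n) (hf : σ.flips = 0) :
    Runs E .sample σ ((1000 * (n + 1) + 8) * (M + 1)) fun σ' =>
      (∃ L : List (Finset (Fin n)), L.Nodup ∧ (∀ Y, Y ∈ L ↔ ∃ k < M,
        Balanced β (coinSet n E.coin (k * n)) ∧
          (Y = coinSet n E.coin (k * n) ∨ Y = (coinSet n E.coin (k * n))ᶜ)) ∧
        Rep L (fun _ => 0) σ') ∧ Par n s M β σ' := by
  have hn : n < 2 ^ n := Nat.lt_two_pow_self
  have hw0 : 0 < E.w := by
    by_contra h
    have : E.w = 0 := by omega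
    rw [this] at hw
    omega
  refine .forUpto M (fun j σ' =>
      (∃ L : List (Finset (Fin n)), L.Nodup ∧ (∀ Y, Y ∈ L ↔ ∃ k < j,
        Balanced β (coinSet n E.coin (k * n)) ∧
          (Y = coinSet n E.coin (k * n) ∨ Y = (coinSet n E.coin (k * n))ᶜ)) ∧
        Rep L (fun _ => 0) σ') ∧ Par n s M β σ' ∧ σ'.flips = j * n) (by omega) hw0 ?_ ?_ ?_ ?_
  · exact ⟨⟨[], List.nodup_nil, by simp, hR.setVar (by omega) _⟩, hP.setVar (by omega) _,
      by simp [hf]⟩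
  · exact fun k σ h => h.2.1.v2
  · rintro k σ' hk h10 ⟨⟨L, hL, hm, hR⟩, hP, hf⟩
    refine (runs_sampleOnce hw hR hL hP hβ).mono le_rfl ?_
    rintro σ₁ ⟨⟨L₁, hL₁, hm₁, hR₁⟩, hP₁, h10₁, hf₁⟩
    refine ⟨h10₁.trans h10, ⟨L₁, hL₁, fun Y => ?_, hR₁.setVar (by omega) _⟩,
      hP₁.setVar (by omega) _, ?_⟩
    · rw [hm₁, hm, hf]
      constructor
      · rintro (⟨j, hj, h⟩ | h)
        · exact ⟨j, by omega, h⟩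
        · exact ⟨k, by omega, h⟩
      · rintro ⟨j, hj, h⟩
        by_cases hjk : j = k
        · exact .inr (hjk ▸ h)
        · exact .inl ⟨j, by omega, h⟩
    · rw [State.setVar_flips, hf₁, hf, Nat.succ_mul]
  · rintro σ' ⟨h, hP, -⟩
    exact ⟨h, hP⟩

end WordRAM

namespace WordRAM
variable {n : ℕ} {E : Env n}

open SetPartitionInstance (wordBound radix_pos)

theorem mem_take_succ {α : Type*} {L : List α} {k : ℕ} (h : k < L.length) (Y : α) :
    Y ∈ L.take (k + 1) ↔ Y ∈ L.take k ∨ Y = L[k] := by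
  rw [List.take_succ_eq_append_getElem h, List.mem_append, List.mem_singleton]

/-! ### Closing the list downwards -/

/-- Handle the set in variable `12`: add its subsets with one member less to the list, and store
its weight. -/
def Cmd.expandOnce : Cmd :=
  .seq (.assign 12 (.load (.tri (.var 10) 1))) (.seq (.assign 13 (.var 5)) (.seq
    (.forUpto 11 0 (.ite (.bit (.var 12) (.var 11))
      (.seq (.assign 13 (.bin .add (.var 13) (.var 4)))
        (.seq (.assign 15 (.clear (.var 12) (.var 11))) .push)) .skip))
    (.seq (.ite (.var 12) (.seq (.query 14 (.var 12))
      (.store (.tri (.var 12) 2) (.bin .shl (.var 14) (.var 13)))) .skip)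
      (.assign 10 (.bin .add (.var 10) (.const 1))))))

def Cmd.expand : Cmd :=
  .seq (.assign 10 (.const 0)) (.while (.bin .lt (.var 10) (.var 7)) .expandOnce)

section expand
variable {s M β m : ℕ} {I : SetPartitionInstance n m s} {D : Finset (Finset (Fin n))}

/-- `D` is a downset fixed beforehand that confines the growing list. Variable `13` starts at `radix
n * radix n` and gains `radix n` per member of `Y`, ending as the exponent of `setWeight Y`. -/
theorem runs_expandLoop {L : List (Finset (Fin n))} {V : Finset (Fin n) → ℕ} {σ : State} {k : ℕ}
    {Y : Finset (Fin n)} (hw : wordBound n + 100 ≤ E.w) (hD : ∀ Y ∈ D, ∀ i, Y.erase i ∈ D)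
    (hR : Rep L V σ) (hP : Par n s M β σ) (hL : L.Nodup) (hLD : ∀ Y ∈ L, Y ∈ D) (hY : Y ∈ L)
    (h10 : σ.var 10 = k) (h12 : σ.var 12 = bits Y) (h13 : σ.var 13 = radix n * radix n) :
    Runs E (.forUpto 11 0 (.ite (.bit (.var 12) (.var 11))
      (.seq (.assign 13 (.bin .add (.var 13) (.var 4)))
        (.seq (.assign 15 (.clear (.var 12) (.var 11))) .push)) .skip)) σ (200 * (n + 1))
      fun σ' => ∃ L' : List (Finset (Fin n)), L'.Nodup ∧ L <+: L' ∧ (∀ Y ∈ L', Y ∈ D) ∧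
        (∀ i ∈ Y, Y.erase i ∈ L') ∧ Rep L' V σ' ∧ Par n s M β σ' ∧ σ'.var 10 = k ∧
        σ'.var 12 = bits Y ∧ σ'.var 13 = radix n * (radix n + Y.card) := by
  have hn : n < 2 ^ n := Nat.lt_two_pow_self
  have hW := two_pow_mul_le hw
  have hww : E.w < 2 ^ E.w := Nat.lt_two_pow_self
  obtain ⟨-, -, -, hr, -⟩ := radix_facts n
  apply Runs.within
  · apply Runs.forUpto n (fun j σ' => ∃ L' : List (Finset (Fin n)), L'.Nodup ∧ L <+: L' ∧
        (∀ Y ∈ L', Y ∈ D) ∧ (∀ i ∈ Y, (i : ℕ) < j → Y.erase i ∈ L') ∧ Rep L' V σ' ∧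
        Par n s M β σ' ∧ σ'.var 10 = k ∧ σ'.var 12 = bits Y ∧
        σ'.var 13 = radix n * (radix n + (Y.filter fun i : Fin n => (i : ℕ) < j).card))
      (by omega) (by omega)
    · exact ⟨L, hL, List.prefix_rfl, hLD, by simp, hR.setVar (by omega) _, hP.setVar (by omega) _,
        by simpa using h10, by simpa using h12, by simpa using h13⟩
    · rintro j σ' ⟨L', -, -, -, -, -, hP, -⟩
      exact hP.v0
    · rintro j σ' hj h11 ⟨L', hL', hpre, hD', hcl, hR, hP, h10, h12, h13⟩
      have ev := eval_bit (k := ⟨j, hj⟩) (e := .var 12) (i := .var 11) hW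
        (eval_var (σ := σ') _ h12) (eval_var _ h11)
      have hcd := (bits_filter_succ Y j hj).2
      apply Runs.ite
      · intro h
        rw [ev] at h
        have hjY : (⟨j, hj⟩ : Fin n) ∈ Y := by by_contra hc; simp [hc] at h
        rw [decide_eq_true hjY] at hcd
        have hle : radix n * (radix n + (Y.filter fun i : Fin n => (i : ℕ) < j + 1).card) ≤
            radix n * (radix n + n) := by
          refine Nat.mul_le_mul_left _ (Nat.add_le_add_left ?_ _)
          simpa using Finset.card_le_univ (Y.filter fun i : Fin n => (i : ℕ) < j + 1)
        have e13 : radix n * (radix n + (Y.filter fun i : Fin n => (i : ℕ) < j + 1).card) =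
            radix n * (radix n + (Y.filter fun i : Fin n => (i : ℕ) < j).card) + radix n := by
          rw [hcd, Bool.toNat_true]; ring
        apply Runs.seq
        apply Runs.assign _ (eval_add (eval_var _ h13) (eval_var _ hP.v4) (by omega))
        apply Runs.seq
        apply Runs.assign _ (eval_clear hW hjY (eval_var _ (by simpa using h12))
          (eval_var _ (by simpa using h11)))
        refine (runs_push (X := Y.erase ⟨j, hj⟩) hW ((hR.setVar (by omega) _).setVar (by omega) _)
          hL' (by simp)).mono le_rfl ?_
        rintro σ₁ ⟨⟨L₁, hL₁, hpre₁, hm₁, hR₁⟩, -, hv⟩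
        refine ⟨?_, L₁, hL₁, hpre.trans hpre₁, fun Z hZ => ?_, fun i hi hij => ?_,
          hR₁.setVar (by omega) _, hP.congr fun i hi => ?_, ?_, ?_, ?_⟩
        · rw [hv _ (by omega) (by omega)]; simpa using h11
        · rcases (hm₁ Z).1 hZ with h | h
          · exact hD' Z h
          · exact h ▸ hD Y (hLD Y hY) _
        · by_cases hij' : (i : ℕ) = j
          · have : i = ⟨j, hj⟩ := Fin.ext hij'
            exact (hm₁ _).2 (.inr (by rw [this]))
          · exact hpre₁.subset (hcl i hi (by omega))
        · rw [State.setVar_var, if_neg (by omega), hv _ (by omega) (by omega), State.setVar_var,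
            if_neg (by omega), State.setVar_var, if_neg (by omega)]
        · rw [State.setVar_var, if_neg (by omega), hv _ (by omega) (by omega)]; simpa using h10
        · rw [State.setVar_var, if_neg (by omega), hv _ (by omega) (by omega)]; simpa using h12
        · rw [State.setVar_var, if_neg (by omega), hv _ (by omega) (by omega), e13]; simp
      · intro h
        rw [ev] at h
        have hjY : (⟨j, hj⟩ : Fin n) ∉ Y := by intro hc; simp [hc] at h
        rw [decide_eq_false hjY, Bool.toNat_false, add_zero] at hcd
        refine .skip ⟨by simpa using h11, L', hL', hpre, hD', fun i hi hij => ?_,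
          (hR.setVar (by omega) _).setVar (by omega) _,
          (hP.setVar (by omega) _).setVar (by omega) _, by simpa using h10, by simpa using h12,
          by rw [hcd]; simpa using h13⟩
        by_cases hij' : (i : ℕ) = j
        · have : i = ⟨j, hj⟩ := Fin.ext hij'
          exact absurd (this ▸ hi) hjY
        · exact hcl i hi (by omega)
    · rintro σ' ⟨L', hL', hpre, hD', hcl, hR, hP, h10, h12, h13⟩
      refine ⟨L', hL', hpre, hD', fun i hi => hcl i hi i.2, hR, hP, h10, h12, ?_⟩
      simpa using h13
  · simp only [Expr.cost, Expr.bit, Expr.clear]; omega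

theorem runs_expandOnce {L : List (Finset (Fin n))} {σ : State} {k : ℕ}
    (hw : wordBound n + 100 ≤ E.w) (hE : E.oracle = I.member)
    (hD : ∀ Y ∈ D, ∀ i, Y.erase i ∈ D)
    (hL : L.Nodup) (hLD : ∀ Y ∈ L, Y ∈ D) (hk : k < L.length)
    (hcl : ∀ Y ∈ L.take k, ∀ i ∈ Y, Y.erase i ∈ L)
    (hR : Rep L (fun Y => if Y ∈ L.take k then I.zetaVal 0 Y else 0) σ) (hP : Par n s M β σ)
    (h10 : σ.var 10 = k) :
    Runs E .expandOnce σ (300 * (n + 1) + E.T)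
      fun σ' => ∃ L' : List (Finset (Fin n)), L'.Nodup ∧ L <+: L' ∧ (∀ Y ∈ L', Y ∈ D) ∧
        (∀ Y ∈ L'.take (k + 1), ∀ i ∈ Y, Y.erase i ∈ L') ∧
        Rep L' (fun Y => if Y ∈ L'.take (k + 1) then I.zetaVal 0 Y else 0) σ' ∧ Par n s M β σ' ∧
        σ'.var 10 = k + 1 := by
  have hn : n < 2 ^ n := Nat.lt_two_pow_self
  have hW := two_pow_mul_le hw
  have hww : E.w < 2 ^ E.w := Nat.lt_two_pow_self
  obtain ⟨-, -, -, hr, -⟩ := radix_facts n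
  have hlen := length_le_two_pow hL
  set Y := L[k] with hY
  have hYb := bits_lt Y
  apply Runs.within
  · apply Runs.seq
    apply Runs.assign _ (eval_load (eval_tri (eval_var _ h10) (by omega) (by omega))
      (hR.list k hk))
    apply Runs.seq
    apply Runs.assign _ (eval_var (σ := State.setVar _ _ _) 5 (by simpa using hP.v5))
    apply Runs.seq
    refine (runs_expandLoop (Y := Y) hw hD ((hR.setVar (by omega) _).setVar (by omega) _)
      ((hP.setVar (by omega) _).setVar (by omega) _) hL hLD (List.getElem_mem hk)
      (by simpa using h10) (by simp [hY]) (by simp)).mono le_rfl ?_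
    rintro σ₁ ⟨L', hL', hpre, hD', hcl', hR', hP', h10', h12', h13'⟩
    obtain ⟨t, rfl⟩ := hpre
    have hk' : k < (L ++ t).length := by rw [List.length_append]; omega
    have htake : (L ++ t).take k = L.take k := List.take_append_of_le_length hk.le
    have hget : (L ++ t)[k] = Y := List.getElem_append_left hk
    have hmem : ∀ Z, Z ∈ (L ++ t).take (k + 1) ↔ Z ∈ L.take k ∨ Z = Y := fun Z => by
      rw [mem_take_succ hk', htake, hget]
    have final : ∀ σ₂, Rep (L ++ t) (Function.update
        (fun Y => if Y ∈ L.take k then I.zetaVal 0 Y else 0) Y (I.zetaVal 0 Y)) σ₂ →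
        Par n s M β σ₂ → σ₂.var 10 = k →
        Runs E (.assign 10 (.bin .add (.var 10) (.const 1))) σ₂ 4 fun σ' =>
        ∃ L' : List (Finset (Fin n)), L'.Nodup ∧ L <+: L' ∧ (∀ Y ∈ L', Y ∈ D) ∧
        (∀ Y ∈ L'.take (k + 1), ∀ i ∈ Y, Y.erase i ∈ L') ∧
        Rep L' (fun Y => if Y ∈ L'.take (k + 1) then I.zetaVal 0 Y else 0) σ' ∧ Par n s M β σ' ∧
        σ'.var 10 = k + 1 := by
      intro σ₂ hR₂ hP₂ h10₂
      refine .assign (k + 1) (eval_add (eval_var _ h10₂) (eval_const (by omega)) (by omega))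
        ⟨L ++ t, hL', List.prefix_append _ _, hD', fun Z hZ i hi => ?_, ?_,
          hP₂.setVar (by omega) _, by simp⟩
      · rcases (hmem Z).1 hZ with h | h
        · exact List.mem_append_left _ (hcl Z h i hi)
        · subst h; exact hcl' i hi
      · have e : (fun Z => if Z ∈ (L ++ t).take (k + 1) then I.zetaVal 0 Z else 0) =
            Function.update (fun Y => if Y ∈ L.take k then I.zetaVal 0 Y else 0) Y
              (I.zetaVal 0 Y) := by
          funext Z
          by_cases hZ : Z = Y
          · simp [hmem, hZ]
          · simp [hmem, hZ]
        rw [e]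
        exact hR₂.setVar (by omega) _
    have hcY : radix n * (radix n + Y.card) ≤ radix n * (radix n + n) :=
      Nat.mul_le_mul_left _ (Nat.add_le_add_left (by simpa using Finset.card_le_univ Y) _)
    have hpow : 2 ^ (radix n * (radix n + Y.card)) < 2 ^ E.w :=
      Nat.pow_lt_pow_right (by norm_num) (by omega)
    apply Runs.seq
    apply Runs.ite
    · intro h
      rw [eval_var _ h12'] at h
      have hY0 : Y ≠ ∅ := by rintro hc; simp [hc] at h
      apply Runs.seq
      apply Runs.query (by omega) _ (eval_var _ h12')
      have hv : (open Classical in if E.oracle (subsetOfBits n (bits Y)) then 1 else 0) *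
          2 ^ (radix n * (radix n + Y.card)) = I.zetaVal 0 Y := by
        have hp : Y ∈ I.parts ↔ I.member Y := by simp [SetPartitionInstance.parts, hY0]
        rw [subsetOfBits_bits, hE, I.zetaVal_zero]
        by_cases hm : I.member Y <;> simp [hp, hm, setWeight]
      refine .store _ _ (eval_tri (eval_var _ (by simpa using h12')) (by omega) (by omega))
        ((eval_shl (eval_var _ (by simp)) (eval_var _ (by simpa using h13')) ?_).trans hv) ?_
      · refine lt_of_le_of_lt (Nat.mul_le_mul_right _ ?_) (by rwa [one_mul])
        split_ifs <;> omega
      · exact final _ ((hR'.setVar (by omega) _).setVal _ _)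
          ((hP'.setVar (by omega) _).setMem _ _) (by simpa using h10')
    · intro h
      -- The empty set is not a part: no query is made, and its value stays 0.
      rw [eval_var _ h12', ← bits_empty (n := n), bits_inj] at h
      apply Runs.skip
      refine final _ ?_ (hP'.setVar (by omega) _) (by simpa using h10')
      have hz : I.zetaVal 0 Y = 0 := by
        rw [I.zetaVal_zero, h]; simp [SetPartitionInstance.parts]
      have hup : Function.update (fun Y => if Y ∈ L.take k then I.zetaVal 0 Y else 0) Y
          (I.zetaVal 0 Y) = fun Y => if Y ∈ L.take k then I.zetaVal 0 Y else 0 := by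
        rw [Function.update_eq_self_iff, hz]; simp
      rw [hup]
      exact hR'.setVar (by omega) _
  · simp only [Expr.cost, Expr.tri]; omega

/-- The list serves as queue and as set of visited sets. It has no repetitions and stays inside `D`,
so there are at most `D.card` passes, each with at most one query. -/
theorem runs_expand {L : List (Finset (Fin n))} {σ : State}
    (hw : wordBound n + 100 ≤ E.w) (hE : E.oracle = I.member)
    (hD : ∀ Y ∈ D, ∀ i, Y.erase i ∈ D)
    (hL : L.Nodup) (hLD : ∀ Y ∈ L, Y ∈ D)
    (hR : Rep L (fun _ => 0) σ) (hP : Par n s M β σ) :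
    Runs E .expand σ ((300 * (n + 1) + E.T + 4) * (D.card + 1) + 10)
      fun σ' => ∃ L' : List (Finset (Fin n)), L'.Nodup ∧ L <+: L' ∧ (∀ Y ∈ L', Y ∈ D) ∧
        (∀ Y ∈ L', ∀ i ∈ Y, Y.erase i ∈ L') ∧
        Rep L' (fun Y => if Y ∈ L' then I.zetaVal 0 Y else 0) σ' ∧ Par n s M β σ' := by
  have hW := two_pow_mul_le hw
  have hn : 0 < 2 ^ n := by positivity
  apply Runs.within
  · apply Runs.seq
    apply Runs.assign 0 (eval_const (by omega))
    apply Runs.while D.card (fun k σ' => ∃ L' : List (Finset (Fin n)), k ≤ L'.length ∧ L'.Nodup ∧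
      L <+: L' ∧ (∀ Y ∈ L', Y ∈ D) ∧ (∀ Y ∈ L'.take k, ∀ i ∈ Y, Y.erase i ∈ L') ∧
      Rep L' (fun Y => if Y ∈ L'.take k then I.zetaVal 0 Y else 0) σ' ∧ Par n s M β σ' ∧
        σ'.var 10 = k)
    · exact ⟨L, Nat.zero_le _, hL, List.prefix_rfl, hLD, by simp,
        by simpa using hR.setVar (by omega) _, hP.setVar (by omega) _, by simp⟩
    · rintro k σ' ⟨L', hk, hL', hpre, hD', hcl, hR, hP, h10⟩ h
      rw [eval_lt (by omega) (eval_var _ h10) (eval_var _ hR.len)] at h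
      have hk : k < L'.length := by by_contra hc; simp [hc] at h
      refine ⟨?_, (runs_expandOnce hw hE hD hL' hD' hk hcl hR hP h10).mono le_rfl ?_⟩
      · rw [← List.toFinset_card_of_nodup hL'] at hk
        exact hk.trans_le (Finset.card_le_card fun Y hY => hD' Y (List.mem_toFinset.1 hY))
      · rintro σ₁ ⟨L₁, hL₁, hpre₁, h⟩
        exact ⟨L₁, by have := hpre₁.length_le; omega, hL₁, hpre.trans hpre₁, h⟩
    · rintro k σ' ⟨L', hk, hL', hpre, hD', hcl, hR, hP, h10⟩ h
      rw [eval_lt (by omega) (eval_var _ h10) (eval_var _ hR.len)] at h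
      have hk : L'.length ≤ k := by by_contra hc; simp [show k < L'.length by omega] at h
      rw [List.take_of_length_le hk] at hcl
      simp only [List.take_of_length_le hk] at hR
      exact ⟨L', hL', hpre, hD', hcl, hR, hP⟩
  · simp only [Expr.cost]
    ring_nf
    omega

end expand

end WordRAM

namespace WordRAM
variable {n : ℕ} {E : Env n}

open SetPartitionInstance (wordBound radix_pos)

/-! ### Replacing the values of the listed sets one by one -/

/-- The values `g` on the first `k` members of `L`, the values `f` on the others. -/
def stage (L : List (Finset (Fin n))) (f g : Finset (Fin n) → ℕ) (k : ℕ) (Y : Finset (Fin n)) : ℕ :=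
  if Y ∈ L.take k then g Y else if Y ∈ L then f Y else 0

section stage
variable {L : List (Finset (Fin n))} {f g : Finset (Fin n) → ℕ} {k : ℕ}

theorem stage_zero : stage L f g 0 = fun Y => if Y ∈ L then f Y else 0 := by
  funext Y; simp [stage]

theorem stage_length : stage L f g L.length = fun Y => if Y ∈ L then g Y else 0 := by
  funext Y; by_cases h : Y ∈ L <;> simp [stage, h]

theorem stage_succ (h : k < L.length) :
    stage L f g (k + 1) = Function.update (stage L f g k) L[k] (g L[k]) := by
  funext Y
  by_cases hY : Y = L[k]
  · simp only [stage, mem_take_succ h, hY, or_true, if_true, Function.update_self]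
  · simp only [stage, mem_take_succ h, hY, or_false, Function.update_of_ne, ne_eq,
      not_false_eq_true]

theorem stage_getElem (hL : L.Nodup) (h : k < L.length) : stage L f g k L[k] = f L[k] := by
  have : L[k] ∉ L.take k := by
    have h1 : (L.take k ++ [L[k]]).Nodup := by
      rw [← List.take_succ_eq_append_getElem h]
      exact hL.sublist (List.take_sublist _ _)
    simpa using (List.nodup_append.1 h1).2.2 L[k]
  rw [stage, if_neg this, if_pos (List.getElem_mem h)]

end stage

/-! ### The fast zeta and Möbius transforms -/

def Cmd.transformOnce (op : BinOp) : Cmd :=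
  .seq (.assign 12 (.load (.tri (.var 11) 1))) (.ite (.bit (.var 12) (.var 10))
    (.store (.tri (.var 12) 2) (.bin op (.load (.tri (.var 12) 2))
      (.load (.tri (.clear (.var 12) (.var 10)) 2)))) .skip)

def Cmd.transform (op : BinOp) : Cmd := .forUpto 10 0 (.forUpto 11 7 (.transformOnce op))

section transform
variable {s M β : ℕ} {L : List (Finset (Fin n))}

theorem runs_transformOnce {σ : State} {op : BinOp} {f g : Finset (Fin n) → ℕ} {i : Fin n} {k : ℕ}
    (hw : 64 * 2 ^ n ≤ 2 ^ E.w) (hL : L.Nodup) (hcl : ∀ Y ∈ L, ∀ i ∈ Y, Y.erase i ∈ L)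
    (hop : ∀ Y, i ∈ Y → op.eval E.w (f Y) (f (Y.erase i)) = g Y) (hfg : ∀ Y, i ∉ Y → g Y = f Y)
    (hk : k < L.length) (hR : Rep L (stage L f g k) σ) (hP : Par n s M β σ)
    (h10 : σ.var 10 = i) (h11 : σ.var 11 = k) :
    Runs E (.transformOnce op) σ 100 fun σ' => Rep L (stage L f g (k + 1)) σ' ∧ Par n s M β σ' ∧
      σ'.var 10 = i ∧ σ'.var 11 = k := by
  have hlen := length_le_two_pow hL
  have hY := bits_lt L[k]
  have hYi := bits_lt (L[k].erase i)
  apply Runs.within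
  · apply Runs.seq
    apply Runs.assign _ (eval_load (eval_tri (eval_var _ h11) (by omega) (by omega))
      (hR.list k hk))
    have hR' := hR.setVar (show 7 < 12 by omega) (bits L[k])
    have ev12 : (Expr.var 12).eval E.w (σ.setVar 12 (bits L[k])) = bits L[k] := eval_var _ (by simp)
    have ev10 : (Expr.var 10).eval E.w (σ.setVar 12 (bits L[k])) = i :=
      eval_var _ (by simpa using h10)
    have ev := eval_bit hw ev12 ev10
    apply Runs.ite
    · intro h
      rw [ev] at h
      have hi : i ∈ L[k] := by by_contra hc; simp [hc] at h
      -- Updating in place is safe: the value at `L[k].erase i` may have been replaced already, but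
      -- a set without `i` keeps its value in this round.
      have e2 : stage L f g k (L[k].erase i) = f (L[k].erase i) := by
        unfold stage
        split_ifs with h1 h2
        · exact hfg _ (Finset.notMem_erase _ _)
        · rfl
        · exact absurd (hcl _ (List.getElem_mem hk) i hi) h2
      have l1 := eval_load (eval_tri ev12 (show 2 < 3 by omega) (by omega)) (hR'.val L[k])
      have l2 := eval_load (eval_tri (eval_clear hw hi ev12 ev10) (show 2 < 3 by omega) (by omega))
        (hR'.val (L[k].erase i))
      rw [stage_getElem hL hk] at l1
      rw [e2] at l2
      refine .store _ (g L[k]) (eval_tri ev12 (by omega) (by omega)) ?_ ⟨?_,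
        (hP.setVar (by omega) _).setMem _ _, by simpa using h10, by simpa using h11⟩
      · rw [Expr.eval, l1, l2]; exact hop _ hi
      · rw [stage_succ hk]
        exact hR'.setVal _ _
    · intro h
      rw [ev] at h
      have hi : i ∉ L[k] := by intro hc; simp [hc] at h
      refine .skip ⟨?_, (hP.setVar (by omega) _).setVar (by omega) _, by simpa using h10,
        by simpa using h11⟩
      have : stage L f g (k + 1) = stage L f g k := by
        rw [stage_succ hk, hfg _ hi, ← stage_getElem (f := f) (g := g) hL hk, Function.update_eq_self]
      rw [this]
      exact hR'.setVar (by omega) _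
  · simp [Expr.cost, Expr.tri, Expr.bit, Expr.clear]

/-- `A` lists the functions after each round, so addition gives the zeta and subtraction the Möbius
transform. Closure under `erase` ensures that only listed sets are read. -/
theorem runs_transform {σ : State} {op : BinOp} (A : ℕ → Finset (Fin n) → ℕ)
    (hw : 64 * 2 ^ n ≤ 2 ^ E.w) (hL : L.Nodup) (hcl : ∀ Y ∈ L, ∀ i ∈ Y, Y.erase i ∈ L)
    (hop : ∀ i : Fin n, ∀ Y, i ∈ Y → op.eval E.w (A i Y) (A i (Y.erase i)) = A (i + 1) Y)
    (hA : ∀ i : Fin n, ∀ Y, i ∉ Y → A (i + 1) Y = A i Y)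
    (hR : Rep L (fun Y => if Y ∈ L then A 0 Y else 0) σ) (hP : Par n s M β σ) :
    Runs E (.transform op) σ ((108 * (L.length + 1) + 8) * (n + 1)) fun σ' =>
      Rep L (fun Y => if Y ∈ L then A n Y else 0) σ' ∧ Par n s M β σ' := by
  have hn : n < 2 ^ n := Nat.lt_two_pow_self
  have hw0 : 0 < E.w := by
    by_contra h
    rw [show E.w = 0 by omega] at hw
    omega
  have hlen := length_le_two_pow hL
  refine .forUpto n (fun i σ' => Rep L (fun Y => if Y ∈ L then A i Y else 0) σ' ∧ Par n s M β σ')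
    (by omega) hw0 ⟨hR.setVar (by omega) _, hP.setVar (by omega) _⟩ (fun _ _ h => h.2.v0) ?_
    fun σ h => h
  rintro i σ hi h10 ⟨hR, hP⟩
  refine .forUpto L.length (fun k σ' => Rep L (stage L (A i) (A (i + 1)) k) σ' ∧ Par n s M β σ' ∧
      σ'.var 10 = i) (by omega) hw0 ?_ (fun _ _ h => h.1.len) ?_ ?_
  · rw [stage_zero]
    exact ⟨hR.setVar (by omega) _, hP.setVar (by omega) _, by simpa using h10⟩
  · rintro k σ hk h11 ⟨hR, hP, h10⟩
    refine (runs_transformOnce (i := ⟨i, hi⟩) hw hL hcl (hop ⟨i, hi⟩) (hA ⟨i, hi⟩) hk hR hP h10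
      h11).mono le_rfl ?_
    rintro σ' ⟨hR, hP, h10, h11⟩
    exact ⟨h11, hR.setVar (by omega) _, hP.setVar (by omega) _, by simpa using h10⟩
  · rintro σ ⟨hR, hP, h10⟩
    rw [stage_length] at hR
    exact ⟨h10, hR.setVar (by omega) _, hP.setVar (by omega) _⟩

end transform

/-! ### Power sums -/

def Cmd.powerOnce : Cmd :=
  .seq (.assign 12 (.load (.tri (.var 11) 1))) (.seq (.assign 13 (.load (.tri (.var 12) 2)))
    (.seq (.assign 14 (.const 1)) (.seq
      (.forUpto 10 0 (.assign 14 (.bin .add (.bin .mul (.var 13) (.var 14)) (.const 1))))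
      (.store (.tri (.var 12) 2) (.var 14)))))

def Cmd.power : Cmd := .forUpto 11 7 .powerOnce

section power
variable {s M β m : ℕ} {L : List (Finset (Fin n))}

/-- Horner's rule, `n` passes of `a ↦ P * a + 1` from `a = 1`. Partial sums are bounded by the full
sum, so `hf` excludes overflow throughout. -/
theorem runs_power {σ : State} (f : Finset (Fin n) → ℕ)
    (hw : 64 * 2 ^ n ≤ 2 ^ E.w) (hL : L.Nodup)
    (hf : ∀ Y, ∑ j ∈ Finset.range (n + 1), f Y ^ j < 2 ^ E.w)
    (hR : Rep L (fun Y => if Y ∈ L then f Y else 0) σ) (hP : Par n s M β σ) :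
    Runs E .power σ ((100 * (n + 1)) * (L.length + 1)) fun σ' =>
      Rep L (fun Y => if Y ∈ L then ∑ j ∈ Finset.range (n + 1), f Y ^ j else 0) σ' ∧
        Par n s M β σ' := by
  have hn : n < 2 ^ n := Nat.lt_two_pow_self
  have hw0 : 0 < E.w := by
    by_contra h
    rw [show E.w = 0 by omega] at hw
    omega
  have hlen := length_le_two_pow hL
  refine (Runs.forUpto (τ := 80 * (n + 1)) L.length (fun k σ' => Rep L (stage L f
      (fun Y => ∑ j ∈ Finset.range (n + 1), f Y ^ j) k) σ' ∧ Par n s M β σ')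
      (by omega) hw0 ?_ (fun _ _ h => h.1.len) ?_ fun σ h => by rwa [stage_length] at h).within
      (Nat.mul_le_mul_right _ (by omega))
  · rw [stage_zero]
    exact ⟨hR.setVar (by omega) _, hP.setVar (by omega) _⟩
  rintro k σ hk h11 ⟨hR, hP⟩
  have hY := bits_lt L[k]
  set P := f L[k] with hPdef
  apply Runs.within
  · apply Runs.seq
    apply Runs.assign _ (eval_load (eval_tri (eval_var _ h11) (by omega) (by omega))
      (hR.list k hk))
    have hR₁ := hR.setVar (show 7 < 12 by omega) (bits L[k])
    have l1 := eval_load (eval_tri (eval_var (w := E.w) 12 (show _ = bits L[k] by simp))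
      (show 2 < 3 by omega) (by omega)) (hR₁.val L[k])
    rw [stage_getElem hL hk, ← hPdef] at l1
    apply Runs.seq
    apply Runs.assign P l1
    apply Runs.seq
    apply Runs.assign 1 (eval_const (by omega))
    apply Runs.seq
    apply Runs.forUpto n (fun i σ' => Rep L (stage L f
      (fun Y => ∑ j ∈ Finset.range (n + 1), f Y ^ j) k) σ' ∧ Par n s M β σ' ∧ σ'.var 11 = k ∧
      σ'.var 12 = bits L[k] ∧ σ'.var 13 = P ∧ σ'.var 14 = ∑ j ∈ Finset.range (i + 1), P ^ j)
      (by omega) hw0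
    · refine ⟨((hR₁.setVar ?_ _).setVar ?_ _).setVar ?_ _,
        (((hP.setVar ?_ _).setVar ?_ _).setVar ?_ _).setVar ?_ _, by simpa using h11, by simp,
        by simp, by simp⟩ <;> omega
    · exact fun _ _ h => h.2.1.v0
    · rintro i σ' hi h10 ⟨hR, hP, h11, h12, h13, h14⟩
      have hle : ∑ j ∈ Finset.range (i + 1 + 1), P ^ j ≤ ∑ j ∈ Finset.range (n + 1), P ^ j :=
        Finset.sum_le_sum_of_subset (Finset.range_mono (by omega))
      have hlt := hf L[k]
      rw [← hPdef] at hlt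
      have hg : P * ∑ j ∈ Finset.range (i + 1), P ^ j + 1 =
          ∑ j ∈ Finset.range (i + 1 + 1), P ^ j := geom_sum_succ.symm
      refine .assign _ ((eval_add (eval_mul (eval_var _ h13) (eval_var _ h14) (by omega))
        (eval_const (by omega)) (by omega)).trans hg) ⟨by simpa using h10,
        (hR.setVar (by omega) _).setVar (by omega) _, (hP.setVar (by omega) _).setVar (by omega) _,
        by simpa using h11, by simpa using h12, by simpa using h13, by simp⟩
    · rintro σ' ⟨hR, hP, h11, h12, h13, h14⟩
      refine .store _ _ (eval_tri (eval_var _ h12) (by omega) (by omega)) (eval_var _ h14)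
        ⟨h11, ?_, (hP.setMem _ _).setVar (by omega) _⟩
      rw [stage_succ hk]
      exact (hR.setVal _ _).setVar (by omega) _
  · simp only [Expr.cost, Expr.tri]; omega

end power

/-! ### The decision -/

def Cmd.decideOnce : Cmd :=
  .seq (.assign 12 (.load (.tri (.var 11) 1))) (.seq
    (.assign 13 (.bin .mul (.bin .mul (.load (.tri (.var 12) 2))
      (.load (.tri (.bin .sub (.var 6) (.var 12)) 2))) (.var 16)))
    (.ite (.bin .land (.bin .shr (.var 13) (.var 18)) (.var 19)) (.assign 17 (.const 1)) .skip))

def Cmd.decide : Cmd :=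
  .seq (.query 14 (.const 0)) (.seq
    (.assign 16 (.bin .add (.const 1) (.bin .shl (.var 14) (.var 5)))) (.seq
    (.assign 17 (.const 0)) (.seq
    (.assign 18 (.bin .mul (.var 4) (.bin .add (.bin .mul (.var 4) (.var 1)) (.var 0)))) (.seq
    (.assign 19 (.bin .sub (.bin .shl (.const 1) (.var 4)) (.const 1))) (.seq
    (.forUpto 11 7 .decideOnce) (.assign 0 (.var 17)))))))

section decision
variable {s M β m : ℕ} {I : SetPartitionInstance n m s} {L : List (Finset (Fin n))}

open Classical in
theorem runs_decideOnce {σ : State} {k : ℕ} (hw : wordBound n + 100 ≤ E.w) (hL : L.Nodup)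
    (hk : k < L.length)
    (hR : Rep L (fun Y => if Y ∈ L then I.moebiusVal n Y else 0) σ) (hP : Par n s M β σ)
    (h11 : σ.var 11 = k)
    (h16 : σ.var 16 = 1 + (if I.member ∅ then 1 else 0) * 2 ^ (radix n * radix n))
    (h17 : σ.var 17 ≠ 0 ↔ ∃ Y ∈ L.take k, Yᶜ ∈ L ∧ I.Splits Y)
    (h18 : σ.var 18 = radix n * (radix n * s + n)) (h19 : σ.var 19 = 2 ^ radix n - 1) :
    Runs E .decideOnce σ 200 fun σ' =>
      Rep L (fun Y => if Y ∈ L then I.moebiusVal n Y else 0) σ' ∧ Par n s M β σ' ∧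
      (σ'.var 17 ≠ 0 ↔ ∃ Y ∈ L.take (k + 1), Yᶜ ∈ L ∧ I.Splits Y) ∧
      ∀ i, i = 11 ∨ 16 ≤ i → i ≠ 17 → σ'.var i = σ.var i := by
  have hW := two_pow_mul_le hw
  have hlen := length_le_two_pow hL
  set Y := L[k] with hYdef
  have hYL : Y ∈ L := List.getElem_mem hk
  have hY := bits_lt Y
  have hYc := bits_compl Y
  set c := 1 + (if I.member ∅ then 1 else 0) * 2 ^ (radix n * radix n) with hc
  -- Unlisted sets have value 0 in memory, so the product vanishes when `Yᶜ` is missing and no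
  -- membership test is needed.
  set v := I.moebiusVal n Y * (if Yᶜ ∈ L then I.moebiusVal n Yᶜ else 0) * c with hv
  have hvle : v ≤ I.pairVal Y := by
    rw [hv, SetPartitionInstance.pairVal]
    refine Nat.mul_le_mul_right _ (Nat.mul_le_mul_left _ ?_)
    split_ifs <;> simp
  have hvlt : v < 2 ^ E.w := lt_of_le_of_lt hvle ((I.pairVal_lt Y).trans_le
    (Nat.pow_le_pow_right (by norm_num) (by omega)))
  have hvlt' : I.moebiusVal n Y * (if Yᶜ ∈ L then I.moebiusVal n Yᶜ else 0) < 2 ^ E.w :=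
    lt_of_le_of_lt (Nat.le_mul_of_pos_right _ (by omega)) hvlt
  have hdigit : v / 2 ^ (radix n * (radix n * s + n)) % 2 ^ radix n ≠ 0 ↔
      Yᶜ ∈ L ∧ I.Splits Y := by
    by_cases h : Yᶜ ∈ L
    · rw [hv, if_pos h, hc]
      have := I.digit_pairVal Y
      rw [SetPartitionInstance.pairVal] at this
      rw [this]
      simp [h]
    · simp [hv, h]
  have hnew : (∃ Z ∈ L.take (k + 1), Zᶜ ∈ L ∧ I.Splits Z) ↔
      (∃ Z ∈ L.take k, Zᶜ ∈ L ∧ I.Splits Z) ∨ (Yᶜ ∈ L ∧ I.Splits Y) := by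
    simp only [mem_take_succ hk, or_and_right, exists_or, exists_eq_left, hYdef]
  apply Runs.within
  · apply Runs.seq
    apply Runs.assign _ (eval_load (eval_tri (eval_var _ h11) (by omega) (by omega))
      (hR.list k hk))
    have hR₁ := hR.setVar (show 7 < 12 by omega) (bits Y)
    have hP₁ := hP.setVar (show 7 ≤ 12 by omega) (bits Y)
    have h6 := hP₁.v6
    have ev12 : (Expr.var 12).eval E.w (σ.setVar 12 (bits Y)) = bits Y := eval_var _ (by simp)
    have ev3 : (Expr.bin .sub (.var 6) (.var 12)).eval E.w (σ.setVar 12 (bits Y)) = bits Yᶜ :=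
      (eval_sub (eval_var _ rfl) ev12 (by omega) (by omega)).trans (by omega)
    have l1 := eval_load (eval_tri ev12 (show 2 < 3 by omega) (by omega)) (hR₁.val Y)
    have l2 := eval_load (eval_tri ev3 (show 2 < 3 by omega) (by omega)) (hR₁.val Yᶜ)
    simp only [if_pos hYL] at l1
    apply Runs.seq
    apply Runs.assign v (eval_mul (eval_mul l1 l2 hvlt') (eval_var _ (by simpa using h16)) hvlt)
    have ev : (Expr.bin .land (.bin .shr (.var 13) (.var 18)) (.var 19)).eval E.w
        ((σ.setVar 12 (bits Y)).setVar 13 v) =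
        v / 2 ^ (radix n * (radix n * s + n)) % 2 ^ radix n :=
      eval_land_mask (eval_shr (eval_var _ (by simp)) (eval_var _ (by simpa using h18)) hvlt)
        (eval_var _ (by simpa using h19)) ((Nat.div_le_self _ _).trans_lt hvlt)
    apply Runs.ite
    · intro h
      rw [ev, hdigit] at h
      refine .assign 1 (eval_const (by omega)) ⟨(hR₁.setVar (by omega) _).setVar (by omega) _,
        (hP₁.setVar (by omega) _).setVar (by omega) _, ?_, fun i hi hi' => ?_⟩
      · rw [hnew]; simp [h]
      · simp [hi', show i ≠ 12 by omega, show i ≠ 13 by omega]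
    · intro h
      rw [ev] at h
      have h' : ¬ (Yᶜ ∈ L ∧ I.Splits Y) := fun hc => (hdigit.2 hc) h
      refine .skip ⟨(hR₁.setVar (by omega) _).setVar (by omega) _,
        (hP₁.setVar (by omega) _).setVar (by omega) _, ?_, fun i hi hi' => ?_⟩
      · rw [hnew, or_iff_left h', ← h17]; simp
      · simp [show i ≠ 12 by omega, show i ≠ 13 by omega, show i ≠ 14 by omega]
  · simp [Expr.cost, Expr.tri]

theorem runs_decide {σ : State} (hw : wordBound n + 100 ≤ E.w) (hE : E.oracle = I.member)
    (hL : L.Nodup) (hs : s ≤ n + 1)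
    (hR : Rep L (fun Y => if Y ∈ L then I.moebiusVal n Y else 0) σ) (hP : Par n s M β σ) :
    Runs E .decide σ (208 * (L.length + 1) + E.T + 100) fun σ' =>
      σ'.Yes ↔ ∃ Y ∈ L, Yᶜ ∈ L ∧ I.Splits Y := by
  classical
  have hW := two_pow_mul_le hw
  have hww : E.w < 2 ^ E.w := Nat.lt_two_pow_self
  have hn : n < 2 ^ n := Nat.lt_two_pow_self
  have hlen := length_le_two_pow hL
  obtain ⟨hr1, hr2, hr3, -, hr4⟩ := radix_facts n
  have hr4 := hr4 s hs
  have hrs : radix n * s + n ≤ radix n * (radix n * s + n) := Nat.le_mul_of_pos_left _ (by omega)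
  have hp1 : 2 ^ (radix n * radix n) * 2 ≤ 2 ^ E.w := by
    rw [← pow_succ]; exact Nat.pow_le_pow_right (by norm_num) (by omega)
  have hp2 : 2 ^ radix n * 2 ≤ 2 ^ E.w := by
    rw [← pow_succ]; exact Nat.pow_le_pow_right (by norm_num) (by omega)
  have hp3 : 0 < 2 ^ radix n := by positivity
  have hp4 : 2 < 2 ^ (radix n * radix n) :=
    lt_of_lt_of_le (by norm_num) (Nat.pow_le_pow_right (show 0 < 2 by norm_num)
      (show 2 ≤ radix n * radix n by unfold radix; ring_nf; omega))
  set q : ℕ := if I.member ∅ then 1 else 0 with hq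
  have hq1 : q ≤ 1 := by rw [hq]; split_ifs <;> omega
  have hqp : q * 2 ^ (radix n * radix n) ≤ 1 * 2 ^ (radix n * radix n) :=
    Nat.mul_le_mul_right _ hq1
  have hq' : (if E.oracle (subsetOfBits n 0) then 1 else 0) = q := by
    have h0 : subsetOfBits n 0 = ∅ := by simpa using subsetOfBits_bits (∅ : Finset (Fin n))
    rw [h0, hE]
  apply Runs.within
  · apply Runs.seq
    apply Runs.query (by omega) 0 (eval_const (by omega))
    rw [hq']
    apply Runs.seq
    apply Runs.assign (1 + q * 2 ^ (radix n * radix n)) (eval_add (eval_const (by omega))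
      (eval_shl (eval_var _ (by simp)) (eval_var _ (by simpa using hP.v5)) (by omega)) (by omega))
    apply Runs.seq
    apply Runs.assign 0 (eval_const (by omega))
    apply Runs.seq
    apply Runs.assign (radix n * (radix n * s + n)) (eval_mul (eval_var _ (by simpa using hP.v4))
      (eval_add (eval_mul (eval_var _ (by simpa using hP.v4)) (eval_var _ (by simpa using hP.v1))
        (by omega)) (eval_var _ (by simpa using hP.v0)) (by omega)) (by omega))
    apply Runs.seq
    apply Runs.assign (2 ^ radix n - 1) ((eval_sub (eval_shl (eval_const (by omega))
      (eval_var _ (by simpa using hP.v4)) (by omega)) (eval_const (by omega)) (by omega)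
      (by omega)).trans (by omega))
    apply Runs.seq
    apply Runs.forUpto L.length (fun k σ' =>
      Rep L (fun Y => if Y ∈ L then I.moebiusVal n Y else 0) σ' ∧ Par n s M β σ' ∧
      σ'.var 16 = 1 + q * 2 ^ (radix n * radix n) ∧
      (σ'.var 17 ≠ 0 ↔ ∃ Y ∈ L.take k, Yᶜ ∈ L ∧ I.Splits Y) ∧
      σ'.var 18 = radix n * (radix n * s + n) ∧ σ'.var 19 = 2 ^ radix n - 1) (by omega) (by omega)
    · refine ⟨hR.congr (by simp) (by simp), hP.congr fun i hi => ?_, by simp, by simp, by simp,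
        by simp⟩
      simp [show i ≠ 11 by omega, show i ≠ 14 by omega, show i ≠ 16 by omega,
        show i ≠ 17 by omega, show i ≠ 18 by omega, show i ≠ 19 by omega]
    · exact fun _ _ h => h.1.len
    · rintro k σ' hk h11 ⟨hR, hP, h16, h17, h18, h19⟩
      refine (runs_decideOnce hw hL hk hR hP h11 h16 h17 h18 h19).mono le_rfl ?_
      rintro σ₁ ⟨hR, hP, h, hv⟩
      refine ⟨(hv 11 (by omega) (by omega)).trans h11, hR.setVar (by omega) _,
        hP.setVar (by omega) _, ?_, ?_, ?_, ?_⟩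
      · simpa [hv 16 (by omega) (by omega)] using h16
      · simpa using h
      · simpa [hv 18 (by omega) (by omega)] using h18
      · simpa [hv 19 (by omega) (by omega)] using h19
    · rintro σ' ⟨-, -, -, h17, -⟩
      rw [List.take_length] at h17
      exact .assign _ (eval_var _ rfl) (by simpa [State.Yes] using h17)
  · simp only [Expr.cost]; omega

end decision

end WordRAM

namespace WordRAM
variable {n : ℕ} {E : Env n}

open SetPartitionInstance (wordBound radix_pos)

/-! ### The algorithm -/

/-- The real inputs are needed only as ⌊nζ⌋ and ⌊2nβ⌋; the result is the contents described by
`Par`. -/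
def Cmd.setup : Cmd :=
  .seq (.floorZeta 2 (.var 0)) (.seq
    (.assign 2 (.bin .shl (.const 1) (.bin .sub (.var 0) (.var 2)))) (.seq
    (.floorBeta 3 (.bin .add (.var 0) (.var 0))) (.seq
    (.assign 4 (.bin .mul (.const 2) (.bin .mul (.bin .add (.var 0) (.const 1))
      (.bin .add (.var 0) (.const 1))))) (.seq
    (.assign 5 (.bin .mul (.var 4) (.var 4)))
    (.assign 6 (.bin .sub (.bin .shl (.const 1) (.var 0)) (.const 1)))))))

/-- The whole algorithm. -/
def Cmd.main : Cmd :=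
  .ite (.bin .lt (.bin .add (.var 0) (.const 1)) (.var 1)) (.assign 0 (.const 0))
    (.seq .setup (.seq .sample (.seq .expand (.seq (.transform .add) (.seq .power
      (.seq (.transform .sub) .decide))))))

/-- The number of samples. -/
noncomputable def sampleCount (n : ℕ) (ζ : ℝ) : ℕ := 2 ^ (n - ⌊(n : ℝ) * ζ⌋₊)

/-- The tolerated difference between the sizes of a set and of its complement. -/
noncomputable def tolerance (n : ℕ) (β : ℝ) : ℕ := ⌊((n + n : ℕ) : ℝ) * β⌋₊

open Classical in
/-- The subsets of the balanced ones among the first `M` samples and of their complements. -/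
noncomputable def reach (n M β : ℕ) (coin : ℕ → Bool) : Finset (Finset (Fin n)) :=
  Finset.univ.filter fun Y => ∃ k < M, Balanced β (coinSet n coin (k * n)) ∧
    (Y ⊆ coinSet n coin (k * n) ∨ Y ⊆ (coinSet n coin (k * n))ᶜ)

theorem mem_of_subset_of_erase {L : List (Finset (Fin n))} (h : ∀ Y ∈ L, ∀ i ∈ Y, Y.erase i ∈ L)
    (X : Finset (Fin n)) : X ∈ L → ∀ Y ⊆ X, Y ∈ L := by
  induction X using Finset.strongInduction with
  | H X ih =>
    intro hX Y hY
    rcases hY.eq_or_ssubset with rfl | hss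
    · exact hX
    · obtain ⟨i, hi, hiY⟩ := Finset.exists_of_ssubset hss
      exact ih _ (Finset.erase_ssubset hi) (h X hX i hi) Y (Finset.subset_erase.2 ⟨hY, hiY⟩)

theorem runs_setup {s : ℕ} (hw : wordBound n + 100 ≤ E.w) (hβ : E.β ≤ 1) (hζ : E.ζ ≤ 1) :
    Runs E .setup (init n s) 100 fun σ => Rep ([] : List (Finset (Fin n))) (fun _ => 0) σ ∧
      Par n s (sampleCount n E.ζ) (tolerance n E.β) σ ∧ σ.flips = 0 := by
  have hW := two_pow_mul_le hw
  have hww : E.w < 2 ^ E.w := Nat.lt_two_pow_self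
  have hn : n < 2 ^ n := Nat.lt_two_pow_self
  obtain ⟨hr1, hr2, hr3, -, -⟩ := radix_facts n
  have hf : ⌊(n : ℝ) * E.ζ⌋₊ ≤ n := by
    refine (Nat.floor_le_floor (b := (n : ℝ)) ?_).trans (Nat.floor_natCast n).le
    exact mul_le_of_le_one_right (Nat.cast_nonneg n) hζ
  have ht : tolerance n E.β ≤ n + n := by
    refine (Nat.floor_le_floor (b := ((n + n : ℕ) : ℝ)) ?_).trans (Nat.floor_natCast _).le
    exact mul_le_of_le_one_right (Nat.cast_nonneg _) hβ
  have hM : 2 ^ (n - ⌊(n : ℝ) * E.ζ⌋₊) ≤ 2 ^ n :=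
    Nat.pow_le_pow_right (by norm_num) (Nat.sub_le _ _)
  have hrad : 2 * ((n + 1) * (n + 1)) < 2 ^ E.w := by
    change radix n < _; omega
  apply Runs.within
  · apply Runs.seq
    apply Runs.floorZeta n (eval_var _ (by simp [init])) (by omega)
    apply Runs.seq
    apply Runs.assign (1 * 2 ^ (n - ⌊(n : ℝ) * E.ζ⌋₊)) (eval_shl (eval_const (by omega))
      (eval_sub (eval_var _ (by simp [init])) (eval_var _ (by simp)) (by omega) hf) (by omega))
    apply Runs.seq
    apply Runs.floorBeta (n + n) (eval_add (eval_var _ (by simp [init]))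
      (eval_var _ (by simp [init])) (by omega)) (by unfold tolerance at ht; omega)
    apply Runs.seq
    apply Runs.assign (2 * ((n + 1) * (n + 1))) (eval_mul (eval_const (by omega)) (eval_mul
      (eval_add (eval_var _ (by simp [init])) (eval_const (by omega)) (by omega))
      (eval_add (eval_var _ (by simp [init])) (eval_const (by omega)) (by omega)) (by omega)) hrad)
    apply Runs.seq
    apply Runs.assign (radix n * radix n) (eval_mul (eval_var _ (by simp [radix]))
      (eval_var _ (by simp [radix])) (by omega))
    apply Runs.assign (1 * 2 ^ n - 1) (eval_sub (eval_shl (eval_const (by omega))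
      (eval_var _ (by simp [init])) (by omega)) (eval_const (by omega)) (by omega) (by omega))
    refine ⟨⟨?_, ?_, ?_, ?_⟩, ⟨?_, ?_, ?_, ?_, ?_, ?_, ?_⟩, ?_⟩
    any_goals simp [init, sampleCount, tolerance, radix]
    omega
  · simp [Expr.cost]

theorem runs_main {m s : ℕ} {I : SetPartitionInstance n m s} (hw : wordBound n + 100 ≤ E.w)
    (hE : E.oracle = I.member) (hβ : E.β ≤ 1) (hζ : E.ζ ≤ 1) (hT : 1 ≤ E.T) :
    Runs E .main (init n s) (5000 * ((n + 1) * (sampleCount n E.ζ +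
      (reach n (sampleCount n E.ζ) (tolerance n E.β) E.coin).card + 1) * E.T)) fun σ => σ.Yes ↔
        s ≤ n + 1 ∧ ∃ Y ∈ reach n (sampleCount n E.ζ) (tolerance n E.β) E.coin,
          Yᶜ ∈ reach n (sampleCount n E.ζ) (tolerance n E.β) E.coin ∧ I.Splits Y := by
  have hW := two_pow_mul_le hw
  have hww : E.w < 2 ^ E.w := Nat.lt_two_pow_self
  have hn : n < 2 ^ n := Nat.lt_two_pow_self
  obtain ⟨hr1, hr2, hr3, -, hr4⟩ := radix_facts n
  have hM : sampleCount n E.ζ ≤ 2 ^ n := Nat.pow_le_pow_right (by norm_num) (Nat.sub_le _ _)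
  have ht : tolerance n E.β ≤ 2 * n := by
    rw [two_mul]
    refine (Nat.floor_le_floor (b := ((n + n : ℕ) : ℝ)) ?_).trans (Nat.floor_natCast _).le
    exact mul_le_of_le_one_right (Nat.cast_nonneg _) hβ
  set M := sampleCount n E.ζ
  set β := tolerance n E.β
  set D := reach n M β E.coin with hD
  have hDcl : ∀ Y ∈ D, ∀ i, Y.erase i ∈ D := by
    intro Y hY i
    simp only [hD, reach, Finset.mem_filter, Finset.mem_univ, true_and] at hY ⊢
    obtain ⟨k, hk, hb, h⟩ := hY
    exact ⟨k, hk, hb, h.imp ((Finset.erase_subset _ _).trans) ((Finset.erase_subset _ _).trans)⟩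
  have hmlt : ∀ i Y, I.moebiusVal i Y < 2 ^ E.w := by
    intro i Y
    refine lt_of_le_of_lt (I.moebiusVal_le i Y) (Nat.pow_lt_pow_right (by norm_num)
      (lt_of_lt_of_le ?_ hw))
    have h1 : radix n * (radix n * n + n * n) ≤ radix n * (radix n * (2 * n + 3)) := by
      refine Nat.mul_le_mul_left _ ?_
      have : n * n ≤ radix n * n := Nat.mul_le_mul_right _ hr1.le
      have e : radix n * (2 * n + 3) = radix n * n + radix n * n + 3 * radix n := by ring
      omega
    have h2 : n * n + n ≤ radix n := by unfold radix; ring_nf; omega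
    unfold SetPartitionInstance.wordBound
    omega
  have hzlt : ∀ i Y, I.zetaVal i Y < 2 ^ E.w := by
    intro i Y
    refine lt_of_le_of_lt (I.zetaVal_le i Y) (Nat.pow_lt_pow_right (by norm_num)
      (lt_of_lt_of_le ?_ hw))
    have h1 : radix n * (radix n + n) ≤ radix n * (radix n * (2 * n + 3)) := by
      refine Nat.mul_le_mul_left _ ?_
      have e : radix n * (2 * n + 3) = radix n * n + radix n * n + 3 * radix n := by ring
      omega
    unfold SetPartitionInstance.wordBound
    omega
  apply Runs.within
  · apply Runs.ite
    · intro h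
      rw [eval_lt (by omega) (eval_add (x := n) (eval_var _ (by simp [init]))
        (eval_const (k := 1) (by omega)) (by omega))
        (eval_var _ (show _ = s by simp [init]))] at h
      -- Rejecting large `s` keeps the digit position `radix n * (radix n * s + n)` within the word
      -- bound, and no witness halve is lost.
      have hs : ¬ s ≤ n + 1 := by
        intro hs
        rw [if_neg (by omega)] at h
        exact h rfl
      exact .assign 0 (eval_const (by omega)) (by simp [State.Yes, hs])
    · intro h
      rw [eval_lt (by omega) (eval_add (x := n) (eval_var _ (by simp [init]))
        (eval_const (k := 1) (by omega)) (by omega))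
        (eval_var _ (show _ = s by simp [init]))] at h
      have hs : s ≤ n + 1 := by
        by_contra hs
        rw [if_pos (by omega)] at h
        omega
      refine Runs.within (τ' := 100 + ((1000 * (n + 1) + 8) * (M + 1) +
        (((300 * (n + 1) + E.T + 4) * (D.card + 1) + 10) + ((108 * (D.card + 1) + 8) * (n + 1) +
        ((100 * (n + 1)) * (D.card + 1) + ((108 * (D.card + 1) + 8) * (n + 1) +
        (208 * (D.card + 1) + E.T + 100))))))) (.seq ((runs_setup hw hβ hζ).mono le_rfl ?_)) le_rfl
      rintro σ₀ ⟨hR, hP, hf⟩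
      refine .seq ((runs_sample hW hR hP ht hM hf).mono le_rfl ?_)
      rintro σ₁ ⟨⟨L₀, hL₀, hm₀, hR⟩, hP⟩
      have hLD : ∀ Y ∈ L₀, Y ∈ D := by
        intro Y hY
        obtain ⟨k, hk, hb, h⟩ := (hm₀ Y).1 hY
        simp only [hD, reach, Finset.mem_filter, Finset.mem_univ, true_and]
        exact ⟨k, hk, hb, h.imp (fun h => h.subset) (fun h => h.subset)⟩
      refine .seq ((runs_expand hw hE hDcl hL₀ hLD hR hP).mono le_rfl ?_)
      rintro σ₂ ⟨L, hL, hpre, hLD, hcl, hR, hP⟩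
      -- The final list lies in `D`, contains its generators and is closed downwards, hence equals
      -- `D`.
      have hmem : ∀ Y, Y ∈ L ↔ Y ∈ D := by
        refine fun Y => ⟨hLD Y, fun hY => ?_⟩
        simp only [hD, reach, Finset.mem_filter, Finset.mem_univ, true_and] at hY
        obtain ⟨k, hk, hb, h | h⟩ := hY
        · exact mem_of_subset_of_erase hcl _ (hpre.subset ((hm₀ _).2 ⟨k, hk, hb, .inl rfl⟩)) Y h
        · exact mem_of_subset_of_erase hcl _ (hpre.subset ((hm₀ _).2 ⟨k, hk, hb, .inr rfl⟩)) Y h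
      have hlen : L.length = D.card := by
        rw [← List.toFinset_card_of_nodup hL]
        congr 1
        ext Y
        rw [List.mem_toFinset, hmem]
      rw [← hlen]
      refine .seq ((runs_transform I.zetaVal hW hL hcl (fun i Y hi => ?_)
        (fun i Y hi => I.zetaVal_succ_of_notMem hi) hR hP).mono le_rfl ?_)
      · rw [BinOp.eval, I.zetaVal_succ_of_mem hi, Nat.mod_eq_of_lt (hzlt _ _)]
      rintro σ₃ ⟨hR, hP⟩
      refine .seq ((runs_power (I.zetaVal n) hW hL (fun Y => ?_) hR hP).mono le_rfl ?_)
      · rw [I.geomSum_zetaVal]; exact hmlt _ _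
      rintro σ₄ ⟨hR, hP⟩
      simp only [I.geomSum_zetaVal] at hR
      refine .seq ((runs_transform I.moebiusVal hW hL hcl (fun i Y hi => ?_)
        (fun i Y hi => I.moebiusVal_succ_of_notMem hi) hR hP).mono le_rfl ?_)
      · have h1 := I.moebiusVal_succ_of_mem hi
        have h2 := hmlt i Y
        -- By the recurrence the subtrahend is at most the minuend, so the machine's wrap-around
        -- subtraction is exact.
        have e : I.moebiusVal i Y + (2 ^ E.w - I.moebiusVal i (Y.erase i)) =
            I.moebiusVal (i + 1) Y + 2 ^ E.w := by omega
        rw [BinOp.eval, e, Nat.add_mod_right, Nat.mod_eq_of_lt (hmlt _ _)]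
      rintro σ₅ ⟨hR, hP⟩
      refine (runs_decide hw hE hL hs hR hP).mono le_rfl ?_
      intro σ₆ h
      rw [h]
      simp only [hmem, hs, true_and]
  · simp only [Expr.cost]
    have a1 : (n + 1) * (M + 1) ≤ (n + 1) * (M + D.card + 1) := Nat.mul_le_mul_left _ (by omega)
    have a2 : (n + 1) * (D.card + 1) ≤ (n + 1) * (M + D.card + 1) :=
      Nat.mul_le_mul_left _ (by omega)
    have a3 : M + D.card + 1 ≤ (n + 1) * (M + D.card + 1) := Nat.le_mul_of_pos_left _ (by omega)
    have a5 : (n + 1) * (M + D.card + 1) ≤ (n + 1) * (M + D.card + 1) * E.T :=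
      Nat.le_mul_of_pos_right _ (by omega)
    have a6 : E.T * (D.card + 1) ≤ (n + 1) * (M + D.card + 1) * E.T := by
      rw [mul_comm]; exact Nat.mul_le_mul_right _ (by omega)
    have a7 : E.T ≤ (n + 1) * (M + D.card + 1) * E.T := Nat.le_mul_of_pos_left _ (by omega)
    have a8 : n + 1 ≤ (n + 1) * (M + D.card + 1) := Nat.le_mul_of_pos_right _ (by omega)
    generalize (n + 1) * (M + D.card + 1) * E.T = R at *
    generalize (n + 1) * (M + D.card + 1) = R' at *
    have e1 : (1000 * (n + 1) + 8) * (M + 1) = 1000 * ((n + 1) * (M + 1)) + 8 * (M + 1) := by ring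
    have e2 : (300 * (n + 1) + E.T + 4) * (D.card + 1) = 300 * ((n + 1) * (D.card + 1)) +
        E.T * (D.card + 1) + 4 * (D.card + 1) := by ring
    have e3 : (108 * (D.card + 1) + 8) * (n + 1) = 108 * ((n + 1) * (D.card + 1)) + 8 * (n + 1) :=
      by ring
    have e4 : 100 * (n + 1) * (D.card + 1) = 100 * ((n + 1) * (D.card + 1)) := by ring
    rw [e1, e2, e3, e4]
    omega

end WordRAM

/-! ### Counting subsets -/

section counting
variable {n : ℕ}

theorem sum_pow_card_mul_pow (a b : ℝ) :
    ∑ Y : Finset (Fin n), a ^ Y.card * b ^ (n - Y.card) = (a + b) ^ n := by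
  have := Finset.sum_pow_mul_eq_add_pow a b (Finset.univ : Finset (Fin n))
  simpa using this

/-- The Chernoff bound for the number of small subsets. -/
theorem card_small_le (n : ℕ) (δ : ℝ) (hδ : 0 ≤ δ) :
    ((Finset.univ.filter fun Y : Finset (Fin n) => (Y.card : ℝ) ≤ n / 2 - δ * n).card : ℝ) ≤
      2 ^ n * Real.exp (-(2 * δ ^ 2 * n)) := by
  have h1 : ∀ Y : Finset (Fin n), Real.exp (-(2 * δ)) ^ Y.card * Real.exp (2 * δ) ^ (n - Y.card) =
      Real.exp (2 * δ * (n - 2 * Y.card)) := by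
    intro Y
    rw [← Real.exp_nat_mul, ← Real.exp_nat_mul, ← Real.exp_add,
      Nat.cast_sub (by simpa using Finset.card_le_univ Y)]
    ring_nf
  -- Exponential moment with parameter `2δ`: a small set has weight at least `exp (4δ²n)`, and all
  -- weights sum to a power of `2 cosh (2δ)`, bounded below through `cosh x ≤ exp (x²/2)`.
  have h2 : ((Finset.univ.filter fun Y : Finset (Fin n) =>
      (Y.card : ℝ) ≤ n / 2 - δ * n).card : ℝ) * Real.exp (4 * δ ^ 2 * n) ≤
      (Real.exp (-(2 * δ)) + Real.exp (2 * δ)) ^ n := by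
    rw [← sum_pow_card_mul_pow, ← nsmul_eq_mul]
    refine (Finset.card_nsmul_le_sum _ _ _ fun Y hY => ?_).trans
      (Finset.sum_le_sum_of_subset_of_nonneg (Finset.filter_subset _ _) fun Y _ _ => by positivity)
    rw [h1, Real.exp_le_exp]
    have := (Finset.mem_filter.1 hY).2
    nlinarith
  have h3 : Real.exp (-(2 * δ)) + Real.exp (2 * δ) ≤ 2 * Real.exp (2 * δ ^ 2) := by
    have h := Real.cosh_le_exp_half_sq (2 * δ)
    rw [Real.cosh_eq] at h
    have e : (2 * δ) ^ 2 / 2 = 2 * δ ^ 2 := by ring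
    rw [e] at h
    linarith
  have h4 : (Real.exp (-(2 * δ)) + Real.exp (2 * δ)) ^ n ≤ 2 ^ n * Real.exp (2 * δ ^ 2 * n) := by
    refine (pow_le_pow_left₀ (by positivity) h3 n).trans_eq ?_
    rw [mul_pow, ← Real.exp_nat_mul]
    ring_nf
  have h5 : Real.exp (-(2 * δ ^ 2 * n)) * Real.exp (4 * δ ^ 2 * n) = Real.exp (2 * δ ^ 2 * n) := by
    rw [← Real.exp_add]; ring_nf
  have h6 := Real.exp_pos (4 * δ ^ 2 * n)
  refine le_of_mul_le_mul_right ?_ h6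
  rw [mul_assoc (2 ^ n : ℝ), h5]
  exact h2.trans h4

/-- The number of subsets of `X` that miss at most `r` members of `X`. -/
theorem card_large_subsets_le (X : Finset (Fin n)) (z r : ℝ) (hz : 0 < z) (hz1 : z ≤ 1) :
    ((X.powerset.filter fun Y => (X.card : ℝ) - Y.card ≤ r).card : ℝ) ≤
      Real.exp (z * X.card - r * Real.log z) := by
  -- Weigh `Y` by `z` to the number of missed elements. This is at least `z ^ r` for the counted
  -- sets since `z ≤ 1`, and the total is `(1 + z) ^ |X|`.
  have h2 : ((X.powerset.filter fun Y => (X.card : ℝ) - Y.card ≤ r).card : ℝ) *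
      Real.exp (r * Real.log z) ≤ (1 + z) ^ X.card := by
    rw [← Finset.sum_pow_mul_eq_add_pow, ← nsmul_eq_mul]
    refine (Finset.card_nsmul_le_sum _ _ _ fun Y hY => ?_).trans
      (Finset.sum_le_sum_of_subset_of_nonneg (Finset.filter_subset _ _) fun Y _ _ => by positivity)
    obtain ⟨h1, h2⟩ := Finset.mem_filter.1 hY
    rw [one_pow, one_mul, ← Real.exp_log (pow_pos hz _), Real.exp_le_exp, Real.log_pow,
      Nat.cast_sub (Finset.card_le_card (Finset.mem_powerset.1 h1))]
    exact mul_le_mul_of_nonpos_right h2 (Real.log_nonpos hz.le hz1)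
  have h3 : (1 + z) ^ X.card ≤ Real.exp (z * X.card) := by
    rw [mul_comm, Real.exp_nat_mul]
    exact pow_le_pow_left₀ (by positivity) (by linarith [Real.add_one_le_exp z]) _
  refine le_of_mul_le_mul_right ?_ (Real.exp_pos (r * Real.log z))
  rw [← Real.exp_add, sub_add_cancel]
  exact h2.trans h3

/-- The exponent of `card_large_subsets_le` per unit of `n`, for `|X| ≤ (1/2 + z²)n` and `r = 2z²n`.
Divided by `z`, the claim compares roughly 1.05 at `z = 1/8` with `2 log 2`. -/
theorem entropy_bound (z : ℝ) (hz : 0 < z) (hz8 : z ≤ 1 / 8) :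
    z * (1 / 2 + z ^ 2) - 2 * z ^ 2 * Real.log z ≤ (2 * z - z ^ 4) * Real.log 2 := by
  have l1 := Real.log_two_gt_d9
  have l2 := Real.log_two_lt_d9
  -- The tangent bound is taken at `z = 1/8`, the end of the range, where it is sharp; it replaces
  -- `-log z` by a rational function.
  have h1 : Real.log (1 / (8 * z)) ≤ 1 / (8 * z) - 1 := Real.log_le_sub_one_of_pos (by positivity)
  have h2 : Real.log (1 / (8 * z)) = -(3 * Real.log 2 + Real.log z) := by
    rw [one_div, Real.log_inv, Real.log_mul (by norm_num) hz.ne',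
      show (8 : ℝ) = 2 ^ 3 by norm_num, Real.log_pow]
    norm_num
  rw [h2] at h1
  have h3 : -(2 * z ^ 2 * Real.log z) ≤ 2 * z ^ 2 * (3 * Real.log 2 - 1) + z / 4 := by
    have := mul_le_mul_of_nonneg_left h1 (show 0 ≤ 2 * z ^ 2 by positivity)
    have e : 2 * z ^ 2 * (1 / (8 * z) - 1) = z / 4 - 2 * z ^ 2 := by
      field_simp; ring
    rw [e] at this
    nlinarith
  have h4 : 1 / 2 + z ^ 2 + 2 * z * (3 * Real.log 2 - 1) + 1 / 4 + z ^ 3 * Real.log 2 ≤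
      2 * Real.log 2 := by
    have a1 : z ^ 2 ≤ 1 / 64 := by nlinarith
    have a2 : z ^ 3 ≤ 1 / 64 := by nlinarith
    have a3 : z * (3 * Real.log 2 - 1) ≤ 1 / 8 * (3 * Real.log 2 - 1) :=
      mul_le_mul_of_nonneg_right hz8 (by linarith)
    have a4 : z ^ 3 * Real.log 2 ≤ 1 / 64 * Real.log 2 :=
      mul_le_mul_of_nonneg_right a2 (by linarith)
    linarith
  have h5 := mul_le_mul_of_nonneg_left h4 hz.le
  nlinarith

end counting

namespace WordRAM

/-- The number of sets that the algorithm handles. -/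
theorem card_reach_le (n M : ℕ) (β z : ℝ) (coin : ℕ → Bool) (hz : 0 < z) (hz8 : z ≤ 1 / 8)
    (hβ0 : 0 ≤ β) (hβ : β ≤ z ^ 2) (hM : (M : ℝ) ≤ 2 * 2 ^ ((1 - 2 * z) * (n : ℝ))) :
    ((reach n M (tolerance n β) coin).card : ℝ) ≤ 5 * 2 ^ ((1 - z ^ 4) * (n : ℝ)) := by
  classical
  have hn : (0 : ℝ) ≤ n := Nat.cast_nonneg n
  have htol : (tolerance n β : ℝ) ≤ 2 * n * z ^ 2 := by
    refine (Nat.floor_le (by positivity)).trans ?_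
    push_cast
    nlinarith
  set small := Finset.univ.filter fun Y : Finset (Fin n) => (Y.card : ℝ) ≤ n / 2 - z ^ 2 * n
  -- The value `∅` for oversized `X` makes the bound `hl` hold for every `X`, kept by the algorithm
  -- or not.
  set large : Finset (Fin n) → Finset (Finset (Fin n)) := fun X =>
    if (X.card : ℝ) ≤ (1 / 2 + z ^ 2) * n then
      X.powerset.filter fun Y => (X.card : ℝ) - Y.card ≤ 2 * z ^ 2 * n else ∅ with hlarge
  have hcov : ∀ X Y : Finset (Fin n), (X.card : ℝ) ≤ (1 / 2 + z ^ 2) * n → Y ⊆ X → Y ∉ small →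
      Y ∈ large X := by
    intro X Y hX hYX hY
    simp only [small, Finset.mem_filter, Finset.mem_univ, true_and, not_le] at hY
    simp only [hlarge, if_pos hX, Finset.mem_filter, Finset.mem_powerset]
    exact ⟨hYX, by linarith⟩
  have hsub : reach n M (tolerance n β) coin ⊆ small ∪ (Finset.range M).biUnion fun k =>
      large (coinSet n coin (k * n)) ∪ large (coinSet n coin (k * n))ᶜ := by
    intro Y hY
    simp only [reach, Finset.mem_filter, Finset.mem_univ, true_and] at hY
    obtain ⟨k, hk, ⟨hb1, hb2⟩, h⟩ := hY
    rw [Finset.mem_union, or_iff_not_imp_left]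
    intro hs
    refine Finset.mem_biUnion.2 ⟨k, Finset.mem_range.2 hk, ?_⟩
    generalize coinSet n coin (k * n) = X at *
    have hb1 : 2 * (X.card : ℝ) ≤ n + tolerance n β := by exact_mod_cast hb1
    have hb2 : (n : ℝ) ≤ 2 * X.card + tolerance n β := by exact_mod_cast hb2
    rw [Finset.mem_union]
    rcases h with h | h
    · exact .inl (hcov X Y (by linarith) h hs)
    · refine .inr (hcov Xᶜ Y ?_ h hs)
      rw [Finset.card_compl, Fintype.card_fin, Nat.cast_sub (by simpa using Finset.card_le_univ X)]
      linarith
  have hl : ∀ X, ((large X).card : ℝ) ≤ 2 ^ ((2 * z - z ^ 4) * (n : ℝ)) := by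
    intro X
    by_cases hX : (X.card : ℝ) ≤ (1 / 2 + z ^ 2) * n
    · simp only [hlarge, if_pos hX]
      refine (card_large_subsets_le X z _ hz (by linarith)).trans ?_
      rw [Real.rpow_def_of_pos (by norm_num), Real.exp_le_exp]
      have := mul_le_mul_of_nonneg_right (entropy_bound z hz hz8) hn
      nlinarith [mul_le_mul_of_nonneg_left hX hz.le]
    · simp only [hlarge, if_neg hX, Finset.card_empty, Nat.cast_zero]
      positivity
  have hsm : (small.card : ℝ) ≤ 2 ^ ((1 - z ^ 4) * (n : ℝ)) := by
    refine (card_small_le n (z ^ 2) (by positivity)).trans ?_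
    rw [← Real.rpow_natCast, Real.rpow_def_of_pos (by norm_num), Real.rpow_def_of_pos (by norm_num),
      ← Real.exp_add, Real.exp_le_exp]
    -- Chernoff with `δ = z²` gives the factor `exp (-2z⁴n)`, and `log 2 ≤ 2` turns it into `2 ^
    -- (-z⁴n)`.
    have := Real.log_two_lt_d9
    have h0 : 0 ≤ z ^ 4 * (n : ℝ) := by positivity
    have := mul_le_mul_of_nonneg_left (show Real.log 2 ≤ 2 by linarith) h0
    nlinarith
  have hprod : (2 : ℝ) ^ ((1 - 2 * z) * (n : ℝ)) * 2 ^ ((2 * z - z ^ 4) * (n : ℝ)) =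
      2 ^ ((1 - z ^ 4) * (n : ℝ)) := by
    rw [← Real.rpow_add (by norm_num)]
    ring_nf
  have hcard : ((reach n M (tolerance n β) coin).card : ℝ) ≤ small.card + ∑ k ∈ Finset.range M,
      (((large (coinSet n coin (k * n))).card : ℝ) + (large (coinSet n coin (k * n))ᶜ).card) := by
    have h := (Finset.card_le_card hsub).trans ((Finset.card_union_le _ _).trans
      (Nat.add_le_add_left (Finset.card_biUnion_le.trans
        (Finset.sum_le_sum fun k _ => Finset.card_union_le _ _)) _))
    exact_mod_cast h
  have hsum : ∑ k ∈ Finset.range M, (((large (coinSet n coin (k * n))).card : ℝ) +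
      (large (coinSet n coin (k * n))ᶜ).card) ≤
      M * (2 * 2 ^ ((2 * z - z ^ 4) * (n : ℝ))) := by
    refine (Finset.sum_le_card_nsmul _ _ (2 * 2 ^ ((2 * z - z ^ 4) * (n : ℝ)))
      fun k _ => ?_).trans_eq (by simp)
    linarith [hl (coinSet n coin (k * n)), hl (coinSet n coin (k * n))ᶜ]
  have hpos : (0 : ℝ) ≤ 2 * 2 ^ ((2 * z - z ^ 4) * (n : ℝ)) := by positivity
  have := mul_le_mul_of_nonneg_right hM hpos
  nlinarith

/-- Rounding `nζ` down costs a factor of at most 2. -/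
theorem sampleCount_le (n : ℕ) (ζ : ℝ) (hζ : ζ ≤ 1) :
    (sampleCount n ζ : ℝ) ≤ 2 * 2 ^ ((1 - ζ) * (n : ℝ)) := by
  have h1 : (n : ℝ) * ζ ≤ n := mul_le_of_le_one_right (Nat.cast_nonneg n) hζ
  have hf : ⌊(n : ℝ) * ζ⌋₊ ≤ n := by
    exact (Nat.floor_le_floor h1).trans (Nat.floor_natCast n).le
  rw [sampleCount, Nat.cast_pow, Nat.cast_ofNat, ← Real.rpow_natCast, Nat.cast_sub hf]
  calc (2 : ℝ) ^ ((n : ℝ) - ⌊(n : ℝ) * ζ⌋₊) ≤ 2 ^ (1 + (1 - ζ) * (n : ℝ)) := by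
        refine Real.rpow_le_rpow_of_exponent_le (by norm_num) ?_
        linarith [Nat.lt_floor_add_one ((n : ℝ) * ζ)]
    _ = _ := by rw [Real.rpow_add (by norm_num), Real.rpow_one]

/-- Rounding down also guarantees enough samples: `c * 2 ^ (ζn)` witnesses times the number of
samples is at least `c * 2 ^ n`. -/
theorem le_sampleCount (n : ℕ) (ζ : ℝ) (hζ0 : 0 ≤ ζ) (hζ : ζ ≤ 1) :
    (2 : ℝ) ^ n ≤ 2 ^ (ζ * (n : ℝ)) * sampleCount n ζ := by
  have h1 : (n : ℝ) * ζ ≤ n := mul_le_of_le_one_right (Nat.cast_nonneg n) hζ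
  have hf : ⌊(n : ℝ) * ζ⌋₊ ≤ n := by
    exact (Nat.floor_le_floor h1).trans (Nat.floor_natCast n).le
  rw [sampleCount, Nat.cast_pow, Nat.cast_ofNat, ← Real.rpow_natCast, ← Real.rpow_natCast,
    Nat.cast_sub hf, ← Real.rpow_add (by norm_num)]
  refine Real.rpow_le_rpow_of_exponent_le (by norm_num) ?_
  linarith [Nat.floor_le (show 0 ≤ (n : ℝ) * ζ by positivity)]

/-! ### The probability of sampling from a given family -/

instance : IsProbabilityMeasure coinMeasure := by
  unfold coinMeasure; infer_instance

theorem coinMeasure_cylinder (N : ℕ) (b : ℕ → Bool) :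
    coinMeasure.real {coin | ∀ j < N, coin j = b j} = (1 / 2) ^ N := by
  have h : {coin : ℕ → Bool | ∀ j < N, coin j = b j} =
      Set.pi (Finset.range N : Set ℕ) fun j => {b j} := by
    ext coin; simp
  rw [h, Measure.real, coinMeasure, Measure.infinitePi_pi _ (fun _ _ => measurableSet_singleton _)]
  simp

/-- The event is covered by the cylinders of the first `M * n` coins, one for each of the `(2 ^ n -
|𝒲|) ^ M` sequences of sets outside `𝒲`. The union bound replaces an argument about independence of
the samples. -/
theorem coinMeasure_avoid_le (n M : ℕ) (𝒲 : Finset (Finset (Fin n))) :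
    coinMeasure.real {coin | ∀ k < M, coinSet n coin (k * n) ∉ 𝒲} ≤
      (1 - (𝒲.card : ℝ) / 2 ^ n) ^ M := by
  classical
  set S := Fintype.piFinset fun _ : Fin M => 𝒲ᶜ with hS
  let b : (Fin M → Finset (Fin n)) → ℕ → Bool := fun Y j =>
    Decidable.decide (∃ k : Fin M, ∃ i : Fin n, j = k * n + i ∧ i ∈ Y k)
  have hsub : {coin | ∀ k < M, coinSet n coin (k * n) ∉ 𝒲} ⊆
      ⋃ Y ∈ S, {coin | ∀ j < M * n, coin j = b Y j} := by
    intro coin h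
    simp only [Set.mem_ofPred_eq] at h
    simp only [Set.mem_iUnion, Set.mem_ofPred_eq]
    refine ⟨fun k => coinSet n coin (k * n), by simpa [hS] using fun k : Fin M => h k k.2, ?_⟩
    intro j hj
    have hn : 0 < n := Nat.pos_of_mul_pos_left (Nat.zero_lt_of_lt hj)
    have hk : j / n < M := Nat.div_lt_of_lt_mul (by rwa [mul_comm])
    by_cases hc : coin j = true
    · rw [hc, eq_comm, decide_eq_true_iff]
      refine ⟨⟨j / n, hk⟩, ⟨j % n, Nat.mod_lt _ hn⟩, (Nat.div_add_mod' j n).symm, ?_⟩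
      simp [coinSet, Nat.div_add_mod', hc]
    · rw [Bool.not_eq_true] at hc
      rw [hc, eq_comm, decide_eq_false_iff_not]
      rintro ⟨k, i, rfl, hi⟩
      simp [coinSet, hc] at hi
  have hcard : (S.card : ℝ) = ((2 : ℝ) ^ n - 𝒲.card) ^ M := by
    have hle : 𝒲.card ≤ 2 ^ n := by simpa using Finset.card_le_univ 𝒲
    rw [hS, Fintype.card_piFinset]
    simp [Finset.card_compl, Nat.cast_sub hle]
  calc coinMeasure.real {coin | ∀ k < M, coinSet n coin (k * n) ∉ 𝒲}
      ≤ coinMeasure.real (⋃ Y ∈ S, {coin | ∀ j < M * n, coin j = b Y j}) :=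
        measureReal_mono hsub (measure_ne_top _ _)
    _ ≤ ∑ Y ∈ S, coinMeasure.real {coin | ∀ j < M * n, coin j = b Y j} :=
        measureReal_biUnion_finset_le _ _
    _ = S.card * (1 / 2) ^ (M * n) := by simp [coinMeasure_cylinder]
    _ = (1 - (𝒲.card : ℝ) / 2 ^ n) ^ M := by
        rw [hcard, mul_comm M n, pow_mul, ← mul_pow]
        congr 1
        rw [one_div, inv_pow, ← div_eq_mul_inv, sub_div, div_self (by positivity)]

/-- Combine `(1 - x) ^ M ≤ exp (-x * M)` with subadditivity, so that measurability of the events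
plays no role. -/
theorem coinMeasure_hit_ge (n M : ℕ) (𝒲 : Finset (Finset (Fin n))) (c : ℝ)
    (h : c * 2 ^ n ≤ 𝒲.card * M) :
    1 - Real.exp (-c) ≤ coinMeasure.real {coin | ∃ k < M, coinSet n coin (k * n) ∈ 𝒲} := by
  have h1 : 1 ≤ coinMeasure.real {coin | ∃ k < M, coinSet n coin (k * n) ∈ 𝒲} +
      coinMeasure.real {coin | ∀ k < M, coinSet n coin (k * n) ∉ 𝒲} := by
    rw [← probReal_univ (μ := coinMeasure)]
    refine (measureReal_mono fun coin _ => ?_).trans (measureReal_union_le _ _)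
    by_cases hc : ∃ k < M, coinSet n coin (k * n) ∈ 𝒲
    · exact .inl hc
    · push Not at hc
      exact .inr hc
  have hle : (𝒲.card : ℝ) / 2 ^ n ≤ 1 := by
    have : 𝒲.card ≤ 2 ^ n := by simpa using Finset.card_le_univ 𝒲
    rw [div_le_one (by positivity)]
    exact_mod_cast this
  have h2 : (1 - (𝒲.card : ℝ) / 2 ^ n) ^ M ≤ Real.exp (-c) := by
    refine (pow_le_pow_left₀ (by linarith) (Real.one_sub_le_exp_neg _) M).trans ?_
    rw [← Real.exp_nat_mul, Real.exp_le_exp]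
    have : c ≤ 𝒲.card * M / 2 ^ n := by rwa [le_div_iff₀ (by positivity)]
    linarith [show (M : ℝ) * -(𝒲.card / 2 ^ n) = -(𝒲.card * M / 2 ^ n) by ring]
  linarith [coinMeasure_avoid_le n M 𝒲]

theorem balanced_of_isWitnessHalve {n m s : ℕ} {I : SetPartitionInstance n m s} {β : ℝ}
    {W : Finset (Fin n)} (h : I.IsWitnessHalve β W) : Balanced (tolerance n β) W := by
  obtain ⟨⟨h1, h2⟩, -⟩ := h
  -- A difference of integers that is at most `2nβ` is at most its floor, so the rounded tolerance
  -- rejects no witness halve.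
  have key : ∀ a b : ℕ, (a : ℝ) ≤ b + (n + n) * β → a ≤ b + tolerance n β := by
    intro a b hab
    rcases le_total a b with h | h
    · omega
    · have : a - b ≤ tolerance n β := by
        refine Nat.le_floor ?_
        rw [Nat.cast_sub h]
        push_cast
        linarith
      omega
  constructor
  · refine key _ _ ?_
    push_cast
    linarith
  · refine key _ _ ?_
    push_cast
    linarith

end WordRAM

/-! ### Polynomial bounds and assembly. -/

namespace WordRAM

/-- A polynomial bound on the word length that the algorithm needs. -/
noncomputable def wordPoly : Polynomial ℕ :=
  2 * ((.X + 1) * (.X + 1)) + 2 * ((.X + 1) * (.X + 1)) *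
    (2 * ((.X + 1) * (.X + 1)) * (2 * .X + 3)) + 100

theorem eval_wordPoly (n : ℕ) :
    wordPoly.eval n = SetPartitionInstance.wordBound n + 100 := by
  simp [wordPoly, SetPartitionInstance.wordBound, radix]

noncomputable def timePoly : Polynomial ℕ := 40000 * (.X + 1)

theorem exec_main {n m s : ℕ} {I : SetPartitionInstance n m s} {β ζ : ℝ} {T w : ℕ}
    {coin : ℕ → Bool} (hβ : 0 < β) (hζ : 0 < ζ) (hβζ : 2 * Real.sqrt β ≤ ζ) (hζ4 : ζ < 1 / 4)
    (hT : 1 ≤ T) (hw : SetPartitionInstance.wordBound n + 100 ≤ w) :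
    ∃ (σ : State) (t : ℕ), Exec ⟨w, I.member, T, β, ζ, coin⟩ Cmd.main (init n s) σ t ∧
      (t : ℝ) ≤ (2 : ℝ) ^ ((1 - (ζ / 2) ^ 4) * (n : ℝ)) * (timePoly.eval n : ℕ) * T ∧
      (σ.Yes ↔ s ≤ n + 1 ∧ ∃ Y ∈ reach n (sampleCount n ζ) (tolerance n β) coin,
          Yᶜ ∈ reach n (sampleCount n ζ) (tolerance n β) coin ∧ I.Splits Y) := by
  -- The hypothesis `2√β ≤ ζ` in the form used for counting, with `z = ζ / 2`; likewise `ζ < 1/4`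
  -- gives `z ≤ 1/8`.
  have hβ2 : β ≤ (ζ / 2) ^ 2 := by
    rw [← Real.sqrt_le_left (by positivity)]
    linarith
  obtain ⟨σ, t, hex, ht, hyes⟩ := runs_main (E := ⟨w, I.member, T, β, ζ, coin⟩) (I := I) hw rfl
    (by nlinarith : β ≤ 1) (by linarith : ζ ≤ 1) hT
  refine ⟨σ, t, hex, ?_, hyes⟩
  have hM := sampleCount_le n ζ (by linarith)
  have hD := card_reach_le n (sampleCount n ζ) β (ζ / 2) coin (by positivity) (by linarith) hβ.le
    hβ2 (by rwa [mul_div_cancel₀ ζ two_ne_zero])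
  have hz4 : (ζ / 2) ^ 4 ≤ ζ := by
    have h1 : (ζ / 2) ^ 4 ≤ (ζ / 2) ^ 1 :=
      pow_le_pow_of_le_one (by positivity) (by linarith) (by norm_num)
    linarith
  have hn : (0 : ℝ) ≤ n := Nat.cast_nonneg n
  have hMR : (sampleCount n ζ : ℝ) ≤ 2 * 2 ^ ((1 - (ζ / 2) ^ 4) * (n : ℝ)) := by
    refine hM.trans (mul_le_mul_of_nonneg_left (Real.rpow_le_rpow_of_exponent_le (by norm_num) ?_)
      (by norm_num))
    exact mul_le_mul_of_nonneg_right (by linarith) hn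
  have hR : (1 : ℝ) ≤ 2 ^ ((1 - (ζ / 2) ^ 4) * (n : ℝ)) :=
    Real.one_le_rpow (by norm_num) (mul_nonneg (by linarith) hn)
  set R := (2 : ℝ) ^ ((1 - (ζ / 2) ^ 4) * (n : ℝ))
  set D := (reach n (sampleCount n ζ) (tolerance n β) coin).card
  have ht' : (t : ℝ) ≤ 5000 * ((n + 1) * (sampleCount n ζ + D + 1) * T) := by exact_mod_cast ht
  refine ht'.trans ?_
  have he : ((timePoly.eval n : ℕ) : ℝ) = 40000 * (n + 1) := by simp [timePoly]
  rw [he]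
  -- At most `2R` samples, at most `5R` sets, and `1 ≤ R`; hence 40000 = 5000 · 8 in `timePoly`.
  have h8 : (sampleCount n ζ : ℝ) + D + 1 ≤ 8 * R := by linarith
  have hT0 : (0 : ℝ) ≤ (n + 1) * T := by positivity
  calc 5000 * (((n : ℝ) + 1) * (sampleCount n ζ + D + 1) * T)
      = 5000 * ((sampleCount n ζ + D + 1) * ((n + 1) * T)) := by ring
    _ ≤ 5000 * (8 * R * ((n + 1) * T)) := by gcongr
    _ = R * (40000 * (n + 1)) * T := by ring

end WordRAM

open WordRAM in
theorem theorem4 :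
    ∃ (A : Cmd) (wordLength poly : Polynomial ℕ) (p : ℝ → ℝ), (∀ c : ℝ, 0 < c → 0 < p c) ∧
      ∀ (n m s : ℕ) (I : SetPartitionInstance n m s) (β ζ : ℝ) (T w : ℕ),
        0 < β → 0 < ζ → 2 * Real.sqrt β ≤ ζ → ζ < 1 / 4 → 1 ≤ T →
        wordLength.eval n ≤ w → s < 2 ^ w →
        -- worst-case running time
        (∀ coin : ℕ → Bool, ∃ (σ : State) (t : ℕ),
          Exec ⟨w, I.member, T, β, ζ, coin⟩ A (init n s) σ t ∧
          (t : ℝ) ≤ (2 : ℝ) ^ ((1 - (ζ / 2) ^ 4) * (n : ℝ)) * (poly.eval n : ℕ) * T) ∧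
        (I.AtMostOneEmpty →
          -- many witness halves: YES with constant probability
          (∀ c : ℝ, 0 < c →
            c * (2 : ℝ) ^ (ζ * (n : ℝ)) ≤ ({W | I.IsWitnessHalve β W}.ncard : ℝ) →
            p c ≤ coinMeasure.real {coin | ∃ (σ : State) (t : ℕ),
              Exec ⟨w, I.member, T, β, ζ, coin⟩ A (init n s) σ t ∧ σ.Yes}) ∧
          -- no set partition of size `s`: NO, whatever the coin tosses
          (¬ I.HasSetPartition → ∀ (coin : ℕ → Bool) (σ : State) (t : ℕ),
            Exec ⟨w, I.member, T, β, ζ, coin⟩ A (init n s) σ t → ¬ σ.Yes)) := by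
  refine ⟨Cmd.main, wordPoly, timePoly, fun c => 1 - Real.exp (-c), fun c hc => ?_, ?_⟩
  · have : Real.exp (-c) < 1 := by rw [← Real.exp_zero]; exact Real.exp_lt_exp.2 (by linarith)
    linarith
  intro n m s I β ζ T w hβ hζ hβζ hζ4 hT hw _
  rw [eval_wordPoly] at hw
  have run : ∀ coin, _ := fun coin =>
    exec_main (I := I) (coin := coin) hβ hζ hβζ hζ4 hT hw
  refine ⟨fun coin => ?_, fun hI => ⟨fun c hc hcard => ?_, fun hno coin σ t hex hyes => ?_⟩⟩
  · obtain ⟨σ, t, hex, ht, -⟩ := run coin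
    exact ⟨σ, t, hex, ht⟩
  · have hfin := Set.toFinite {W | I.IsWitnessHalve β W}
    have hprob := coinMeasure_hit_ge n (sampleCount n ζ) hfin.toFinset c (by
      rw [← Set.ncard_eq_toFinset_card _ hfin]
      calc c * 2 ^ n ≤ c * (2 ^ (ζ * (n : ℝ)) * sampleCount n ζ) :=
            mul_le_mul_of_nonneg_left (le_sampleCount n ζ hζ.le (by linarith)) hc.le
        _ = c * 2 ^ (ζ * (n : ℝ)) * sampleCount n ζ := by ring
        _ ≤ _ := mul_le_mul_of_nonneg_right hcard (Nat.cast_nonneg _))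
    -- Drawing a witness halve forces YES, so the hitting event lies inside the YES event.
    refine hprob.trans (measureReal_mono ?_ (measure_ne_top _ _))
    rintro coin ⟨k, hk, hW⟩
    have hW : I.IsWitnessHalve β (coinSet n coin (k * n)) := by simpa using hW
    obtain ⟨σ, t, hex, -, hyes⟩ := run coin
    obtain ⟨hsp, hs⟩ := I.splits_of_isWitnessHalve hI hW
    have hb := balanced_of_isWitnessHalve hW
    refine ⟨σ, t, hex, hyes.2 ⟨hs, coinSet n coin (k * n), ?_, ?_, hsp⟩⟩
    · simp only [reach, Finset.mem_filter, Finset.mem_univ, true_and]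
      exact ⟨k, hk, hb, .inl subset_rfl⟩
    · simp only [reach, Finset.mem_filter, Finset.mem_univ, true_and]
      exact ⟨k, hk, hb, .inr subset_rfl⟩
  · obtain ⟨σ', t', hex', -, hyes'⟩ := run coin
    -- By determinism the given run ends in the state whose output has been characterised.
    rw [hex.unique hex'] at hyes
    obtain ⟨-, Y, -, -, hsp⟩ := hyes'.1 hyes
    exact hno (I.hasSetPartition_of_splits hsp)
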